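/- Let $b\in(0,\tfrac12)$, $\hat b=\tfrac12-b$ and $\varkappa>0$. For $\lambda\in\mathbb R\setminus\{0\}$ set $$\mathfrak w(\lambda)=-4\int_{\mathbb R}\frac{\sinh(xb)\,\sinh(x\hat b)\,\sinh(\tfrac x2)\,\cosh x}{x\,\sinh^2 x}\;e^{\mathrm i\lambda x/\pi}\,dx$$ (an oscillatory Riemann integral), $$c(\lambda)=\prod_{\epsilon=\pm1}\frac{\sinh(\lambda-2\mathrm i\pi\epsilon b)}{\sinh\lambda},\qquad \mathfrak w^{(+)}(\lambda)=\mathfrak w(\lambda)+\tfrac12\ln c(\lambda),$$ and $\mathfrak w^{(+)}(0)=-\infty$. For integers $N\ge 2$ and $0\le p\le N$ let $$\mathscr Z_{N,p}(\varkappa)=\frac1{(\ln N)^N}\int_{\mathbb R^p}d^p\nu\int_{\mathbb R^{N-p}}d^{N-p}\lambda\;\prod_{a=1}^{p}e^{-\varkappa\cosh\nu_a}\prod_{a=1}^{N-p}e^{-\varkappa\cosh\lambda_a}\prod_{a<b'}^{p}e^{\mathfrak w(\nu_a-\nu_{b'})}\prod_{a<b'}^{N-p}e^{\mathfrak w(\lambda_a-\lambda_{b'})}\prod_{a=1}^{p}\prod_{b'=1}^{N-p}e^{\mathfrak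 w(\nu_a-\lambda_{b'})}\,c(\nu_a-\lambda_{b'}),$$ and for a Borel probability measure $\sigma$ on $\mathbb R$ let $$\mathcal E_N^{(+)}[\sigma]=\frac{\varkappa}{N}\int\cosh(s\ln N)\,d\sigma(s)-\frac12\iint\mathfrak w^{(+)}\big((s-u)\ln N\big)\,d\sigma(s)\,d\sigma(u)\in(-\infty,+\infty].$$ Then for every $N\ge2$ the functional $\mathcal E_N^{(+)}$ has a unique minimiser $\sigma_{\mathrm{eq}}^{(N)}$ among the Borel probability measures on $\mathbb R$, and its value there is finite. Moreover there is a constant $C>0$, depending only on $b$ and $\varkappa$, such that for all $N\ge2$ and all $0\le p\le N$ $$\mathscr Z_{N,p}(\varkappa)\;\le\;\exp\Big\{-N^2\,\mathcal E_N^{(+)}\big[\sigma_{\mathrm{eq}}^{(N)}\big]+C\,N(\ln N)^2\Big\}.$$ -/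

import Mathlib

open Real Filter Topology MeasureTheory
open scoped ENNReal

namespace SinhGordon

noncomputable section

/-- The amplitude of the Fourier-type representation of the two-body potential,
with `b̂ = 1/2 - b`. It is an even function of `x`. -/
def potentialAmplitude (b x : ℝ) : ℝ :=
  Real.sinh (x * b) * Real.sinh (x * (1 / 2 - b)) * Real.sinh (x / 2) * Real.cosh x
    / (x * Real.sinh x ^ 2)

/-- The two-body potential `𝔴(l)`, `l ≠ 0`, as an oscillatory Riemann integral over `ℝ`
(the limit of the integrals over `[-A, A]` as `A → ∞`). The amplitude being even, only the real
part `cos (l x / π)` of `exp (i l x / π)` contributes. The value at `l = 0` is never used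
(except on null sets). -/
def pairPotential (b l : ℝ) : ℝ :=
  limUnder atTop (fun A : ℝ =>
    -4 * ∫ x in (-A)..A, potentialAmplitude b x * Real.cos (l * x / π))

/-- The factor `∏_{ε = ±} sinh (l - 2 i π ε b) / sinh l` (a real number). -/
def crossFactor (b l : ℝ) : ℝ :=
  ((Complex.sinh ((l : ℂ) - 2 * Complex.I * π * b) / Complex.sinh l) *
    (Complex.sinh ((l : ℂ) + 2 * Complex.I * π * b) / Complex.sinh l)).re

/-- The factor above is real (so that taking the real part loses nothing), and equal to
`(sinh² l + sin² (2πb)) / sinh² l`. -/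
theorem crossFactor_ofReal (b l : ℝ) :
    (Complex.sinh ((l : ℂ) - 2 * Complex.I * π * b) / Complex.sinh l) *
      (Complex.sinh ((l : ℂ) + 2 * Complex.I * π * b) / Complex.sinh l) =
    (((Real.sinh l ^ 2 + Real.sin (2 * π * b) ^ 2) / Real.sinh l ^ 2 : ℝ) : ℂ) := by
  have h : (2 * Complex.I * π * b : ℂ) = ((2 * π * b : ℝ) : ℂ) * Complex.I := by
    push_cast; ring
  rw [h, Complex.sinh_sub, Complex.sinh_add, Complex.sinh_mul_I, Complex.cosh_mul_I]
  have h1 := Complex.cosh_sq (l : ℂ)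
  have h2 := Complex.sin_sq_add_cos_sq ((2 * π * b : ℝ) : ℂ)
  rw [div_mul_div_comm, ← pow_two]
  rw [Complex.ofReal_div, Complex.ofReal_add, Complex.ofReal_pow, Complex.ofReal_pow,
    Complex.ofReal_sinh, Complex.ofReal_sin]
  congr 1
  have h3 : Complex.cos ((2 * π * b : ℝ) : ℂ) ^ 2 = 1 - Complex.sin ((2 * π * b : ℝ) : ℂ) ^ 2 := by
    linear_combination h2
  have hI := Complex.I_sq
  linear_combination (Complex.sinh (l : ℂ) ^ 2) * h3
    + (Complex.sin ((2 * π * b : ℝ) : ℂ) ^ 2) * h1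
    - (Complex.cosh (l : ℂ) ^ 2 * Complex.sin ((2 * π * b : ℝ) : ℂ) ^ 2) * hI

/-- The correcting potential `𝔳_{2πb, 0⁺}`, for `l ≠ 0`. -/
def correctionPotential (b l : ℝ) : ℝ := Real.log (crossFactor b l)

/-- The potential `𝔴⁽⁺⁾ = 𝔴 + (1/2) 𝔳_{2πb, 0⁺}`; since `𝔴⁽⁺⁾(u) = ln |u| + O(1)` at the origin,
its value there is `-∞`. -/
def potentialPlus (b u : ℝ) : EReal :=
  if u = 0 then ⊥ else ((pairPotential b u + 1 / 2 * correctionPotential b u : ℝ) : EReal)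

/-- The Lebesgue integral, with values in `[-∞, +∞]`, of an extended-real function; it is
meaningful as soon as the positive or the negative part has a finite integral. -/
def extIntegral {α : Type*} [MeasurableSpace α] (μ : Measure α) (f : α → EReal) : EReal :=
  ((∫⁻ x, (f x).toENNReal ∂μ : ℝ≥0∞) : EReal) - ((∫⁻ x, (-f x).toENNReal ∂μ : ℝ≥0∞) : EReal)

/-- The rescaled confining potential `V_N(s) = ϰ cosh (s ln N)`. -/
def confiningPotential (kappa : ℝ) (N : ℕ) (s : ℝ) : ℝ :=
  kappa * Real.cosh (Real.log N * s)

/-- The energy functional `ℰ_N⁽⁺⁾` on probability measures on `ℝ`. -/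
def energyPlus (b kappa : ℝ) (N : ℕ) (σ : ProbabilityMeasure ℝ) : EReal :=
  ((1 / (N : ℝ) : ℝ) : EReal) *
      extIntegral (σ : Measure ℝ) (fun s => ((confiningPotential kappa N s : ℝ) : EReal))
    - ((1 / 2 : ℝ) : EReal) *
      extIntegral ((σ : Measure ℝ).prod (σ : Measure ℝ))
        (fun z => potentialPlus b (Real.log N * (z.1 - z.2)))

/-- The integrand of the bounding partition function, in the variables `ν ∈ ℝ^p` and
`l ∈ ℝ^q`, where `q = N - p`. -/
def partitionIntegrand (b kappa : ℝ) {p q : ℕ} (ν : Fin p → ℝ) (l : Fin q → ℝ) : ℝ :=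
  (∏ i, Real.exp (-kappa * Real.cosh (ν i))) *
  (∏ i, Real.exp (-kappa * Real.cosh (l i))) *
  (∏ i, ∏ j ∈ Finset.Ioi i, Real.exp (pairPotential b (ν i - ν j))) *
  (∏ i, ∏ j ∈ Finset.Ioi i, Real.exp (pairPotential b (l i - l j))) *
  (∏ i, ∏ j, (Real.exp (pairPotential b (ν i - l j)) * crossFactor b (ν i - l j)))

/-- The bounding partition function `𝒵_{N,p}(ϰ)`, for `0 ≤ p ≤ N`, as the integral of a nonnegative
function with values in `[0, +∞]`. -/
def partitionFunction (b kappa : ℝ) (N p : ℕ) : ℝ≥0∞ :=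
  ENNReal.ofReal ((1 / Real.log N) ^ N) *
    ∫⁻ ν : Fin p → ℝ, ∫⁻ l : Fin (N - p) → ℝ, ENNReal.ofReal (partitionIntegrand b kappa ν l)

end

end SinhGordon

/-! Everything rests on two amplitudes on the half line, `crossAmplitude` and `plusAmplitude`, both
positive and behaving like a constant over `x` at infinity. Write `T` for the cosine transform.
Euler's sine product gives `ln c = 2 T[cross]` (`log_crossFactor`), and an identity between
hyperbolic functions gives `𝔴 = -2 T[plus] - T[cross]` (`pairPotential_eq`). Hence `𝔴⁽⁺⁾ = -2
T[plus]`: particles of equal type interact through `-2 T[plus] - T[cross]`, particles of different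
types through `-2 T[plus] + T[cross]`.

Energy. Since `plusAmplitude > 0`, the quadratic part of the energy is a weighted `L²` norm of the
characteristic function of the measure (`energyPlus_eq`). It is nonnegative, lower semicontinuous
for weak convergence, and strictly convex by the parallelogram law. The confinement gives tightness
of sublevel sets, so a minimiser exists and is unique.

Upper bound. The transforms are regularised by an Abel factor `exp (-t x)` with `t = 1 / N`. They
increase under this by at most `O(t)`, uniformly in the separation (`le_abelTransform_zero`), so all
pairs together cost `O(N)`. With signs `ε = ±1` marking the two types, the cross terms form `-∑ εᵢ
εⱼ T_t[cross]`, a nonpositive quantity once the diagonal is restored; it can be dropped, and the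
diagonals cost `O(N log N)`. What is left is the regularised energy of all `N` particles, regardless
of type.

That energy dominates, up to the factor `exp (3 / N)`, `N²` times the energy of the empirical
measure smeared by a Gaussian, because Gaussian damping is stronger than Abel damping
(`exp_neg_sq_le`). It is therefore controlled below by the minimum. A fraction `1 / N` of it is kept
to make the integral Gaussian; as the minimum is `O(log N)`, all losses are `O(N log N)`, which is
within the allowed `N (log N)²`. -/

namespace SinhGordon

noncomputable section

/-! ### Oscillating Frullani integrals. -/

/-- The antiderivative of `x ↦ exp (-y x) cos (c x)`. -/
theorem hasDerivAt_exp_mul_cos {y c : ℝ} (h : 0 < y ^ 2 + c ^ 2) (x : ℝ) :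
    HasDerivAt (fun x => Real.exp (-(y * x)) * (c * Real.sin (c * x) - y * Real.cos (c * x))
      / (y ^ 2 + c ^ 2)) (Real.exp (-(y * x)) * Real.cos (c * x)) x := by
  have h1 : HasDerivAt (fun x : ℝ => c * x) c x := by
    simpa using (hasDerivAt_id x).const_mul c
  have h2 : HasDerivAt (fun x : ℝ => -(y * x)) (-y) x := by
    simpa using ((hasDerivAt_id x).const_mul y).fun_neg
  have h3 := (h2.exp.mul ((h1.sin.const_mul c).sub (h1.cos.const_mul y))).div_const (y ^ 2 + c ^ 2)
  refine h3.congr_deriv ?_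
  simp only [Pi.sub_apply]
  field_simp
  ring

theorem integral_exp_mul_cos {y c : ℝ} (h : 0 < y ^ 2 + c ^ 2) (A : ℝ) :
    ∫ x in (0 : ℝ)..A, Real.exp (-(y * x)) * Real.cos (c * x) =
      (y + Real.exp (-(y * A)) * (c * Real.sin (c * A) - y * Real.cos (c * A))) / (y ^ 2 + c ^ 2) := by
  rw [intervalIntegral.integral_eq_sub_of_hasDerivAt (fun x _ => hasDerivAt_exp_mul_cos h x)
    (Continuous.intervalIntegrable (by fun_prop) _ _)]
  simp
  ring

theorem integral_exp_mul_interval {x : ℝ} (hx : x ≠ 0) (α β : ℝ) :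
    ∫ y in α..β, Real.exp (-(y * x)) = (Real.exp (-(α * x)) - Real.exp (-(β * x))) / x := by
  have : ∀ y ∈ Set.uIcc α β, HasDerivAt (fun y => -Real.exp (-(y * x)) / x)
      (Real.exp (-(y * x))) y := by
    intro y _
    have h2 : HasDerivAt (fun y : ℝ => -(y * x)) (-x) y := by
      simpa using ((hasDerivAt_id y).mul_const x).fun_neg
    refine ((h2.exp.fun_neg).div_const x).congr_deriv ?_
    field_simp
  rw [intervalIntegral.integral_eq_sub_of_hasDerivAt this
    (Continuous.intervalIntegrable (by fun_prop) _ _)]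
  ring

theorem integral_div_sq_add_sq {α β c : ℝ} (hα : 0 < α ^ 2 + c ^ 2) (hα0 : 0 ≤ α) (hαβ : α ≤ β) :
    ∫ y in α..β, y / (y ^ 2 + c ^ 2) = 1 / 2 * Real.log ((β ^ 2 + c ^ 2) / (α ^ 2 + c ^ 2)) := by
  have hpos : ∀ y ∈ Set.uIcc α β, 0 < y ^ 2 + c ^ 2 := by
    intro y hy
    rw [Set.uIcc_of_le hαβ] at hy
    have : α ^ 2 ≤ y ^ 2 := pow_le_pow_left₀ hα0 hy.1 2
    linarith
  have hd : ∀ y ∈ Set.uIcc α β, HasDerivAt (fun y => 1 / 2 * Real.log (y ^ 2 + c ^ 2))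
      (y / (y ^ 2 + c ^ 2)) y := by
    intro y hy
    have h1 : HasDerivAt (fun y : ℝ => y ^ 2 + c ^ 2) (2 * y) y := by
      simpa using (hasDerivAt_pow 2 y).add_const (c ^ 2)
    refine ((h1.log (hpos y hy).ne').const_mul (1 / 2)).congr_deriv ?_
    field_simp
  rw [intervalIntegral.integral_eq_sub_of_hasDerivAt hd, Real.log_div
    (hpos β Set.right_mem_uIcc).ne' (hpos α Set.left_mem_uIcc).ne']
  · ring
  · apply ContinuousOn.intervalIntegrable
    apply ContinuousOn.div (by fun_prop) (by fun_prop)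
    exact fun y hy => (hpos y hy).ne'

/-- Frullani's integral with an oscillating factor. -/
theorem tendsto_frullani {α β c : ℝ} (hα : 0 < α ^ 2 + c ^ 2) (hα0 : 0 ≤ α) (hαβ : α ≤ β) :
    Tendsto (fun A : ℝ => ∫ x in (0 : ℝ)..A,
      (Real.exp (-(α * x)) - Real.exp (-(β * x))) / x * Real.cos (c * x)) atTop
      (𝓝 (1 / 2 * Real.log ((β ^ 2 + c ^ 2) / (α ^ 2 + c ^ 2)))) := by
  have hpos : ∀ y ∈ Set.uIcc α β, 0 ≤ y ∧ y ≤ β ∧ α ^ 2 + c ^ 2 ≤ y ^ 2 + c ^ 2 := by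
    intro y hy
    rw [Set.uIcc_of_le hαβ] at hy
    have : α ^ 2 ≤ y ^ 2 := pow_le_pow_left₀ hα0 hy.1 2
    exact ⟨hα0.trans hy.1, hy.2, by linarith⟩
  -- The Frullani quotient is the integral of `exp (-y x)` over `y ∈ [α, β]`; on a bounded range of
  -- `x` Fubini applies, and the inner integral is elementary.
  have hswap : ∀ A : ℝ, ∫ x in (0 : ℝ)..A,
      (Real.exp (-(α * x)) - Real.exp (-(β * x))) / x * Real.cos (c * x) =
      ∫ y in α..β, (y + Real.exp (-(y * A)) * (c * Real.sin (c * A) - y * Real.cos (c * A)))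
        / (y ^ 2 + c ^ 2) := by
    intro A
    have h1 : ∫ x in (0 : ℝ)..A, (Real.exp (-(α * x)) - Real.exp (-(β * x))) / x * Real.cos (c * x)
        = ∫ x in (0 : ℝ)..A, ∫ y in α..β, Real.exp (-(y * x)) * Real.cos (c * x) := by
      apply intervalIntegral.integral_congr_ae
      have : ∀ᵐ x : ℝ, x ≠ 0 := by simp [ae_iff]
      filter_upwards [this] with x hx _
      rw [intervalIntegral.integral_mul_const, integral_exp_mul_interval hx]
    rw [h1, intervalIntegral_intervalIntegral_swap]
    · apply intervalIntegral.integral_congr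
      intro y hy
      exact integral_exp_mul_cos (hα.trans_le (hpos y hy).2.2) A
    · refine IntegrableOn.mono_set (t := Set.uIcc 0 A ×ˢ Set.uIcc α β) ?_
        (Set.prod_mono Set.uIoc_subset_uIcc Set.uIoc_subset_uIcc)
      apply ContinuousOn.integrableOn_compact (isCompact_uIcc.prod isCompact_uIcc)
      apply Continuous.continuousOn
      simp only [Function.uncurry_def]
      fun_prop
  simp_rw [hswap]
  rw [← integral_div_sq_add_sq hα hα0 hαβ]
  apply intervalIntegral.tendsto_integral_filter_of_dominated_convergence
    (fun _ => (β + (|c| + β)) / (α ^ 2 + c ^ 2))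
  · refine Eventually.of_forall fun A => Measurable.aestronglyMeasurable ?_
    fun_prop
  · filter_upwards [eventually_ge_atTop 0] with A hA
    refine Eventually.of_forall fun y hy => ?_
    obtain ⟨hy0, hyβ, hm⟩ := hpos y (Set.uIoc_subset_uIcc hy)
    rw [norm_div, Real.norm_eq_abs, Real.norm_of_nonneg (hα.le.trans hm)]
    have hn : |c * Real.sin (c * A) - y * Real.cos (c * A)| ≤ |c| + y := by
      refine (abs_sub _ _).trans ?_
      rw [abs_mul, abs_mul, abs_of_nonneg hy0]
      have := abs_sin_le_one (c * A)
      have := abs_cos_le_one (c * A)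
      have := abs_nonneg c
      nlinarith
    have he : Real.exp (-(y * A)) ≤ 1 := Real.exp_le_one_iff.2 (by nlinarith)
    have : |y + Real.exp (-(y * A)) * (c * Real.sin (c * A) - y * Real.cos (c * A))|
        ≤ β + (|c| + β) := by
      refine (abs_add_le _ _).trans ?_
      rw [abs_mul, abs_of_nonneg hy0, abs_of_pos (Real.exp_pos _)]
      have := mul_le_mul he hn (abs_nonneg _) zero_le_one
      linarith
    have hβ : 0 ≤ β := hy0.trans hyβ
    gcongr
  · simp
  -- At `y = 0`, an endpoint when `α = 0`, the boundary term does not decay in `A`; this single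
  -- point is discarded.
  · have : ∀ᵐ y : ℝ, y ≠ 0 := by simp [ae_iff]
    filter_upwards [this] with y hy hyI
    obtain ⟨hy0, hyβ, hm⟩ := hpos y (Set.uIoc_subset_uIcc hyI)
    have hy' : 0 < y := lt_of_le_of_ne hy0 hy.symm
    have h1 : Tendsto (fun A : ℝ => Real.exp (-(y * A)) *
        (c * Real.sin (c * A) - y * Real.cos (c * A))) atTop (𝓝 0) := by
      have h0 : Tendsto (fun A : ℝ => Real.exp (-(y * A))) atTop (𝓝 0) :=
        Real.tendsto_exp_neg_atTop_nhds_zero.comp (tendsto_id.const_mul_atTop hy')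
      have h2 : ∀ A, |c * Real.sin (c * A) - y * Real.cos (c * A)| ≤ |c| + y := by
        intro A
        refine (abs_sub _ _).trans ?_
        rw [abs_mul, abs_mul, abs_of_nonneg hy0]
        have := abs_sin_le_one (c * A)
        have := abs_cos_le_one (c * A)
        have := abs_nonneg c
        nlinarith
      refine squeeze_zero_norm (fun A => ?_) (by simpa using h0.mul_const (|c| + y))
      rw [norm_mul, Real.norm_of_nonneg (Real.exp_pos _).le, Real.norm_eq_abs]
      exact mul_le_mul_of_nonneg_left (h2 A) (Real.exp_pos _).le
    simpa using (h1.const_add y).div_const (y ^ 2 + c ^ 2)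

/-! ### Abel-regularised cosine transforms of amplitudes decaying like `1 / x`. -/

/-- The reference amplitude, behaving like `1 / x` at infinity and regular at the origin. -/
def refProfile (x : ℝ) : ℝ := (1 - Real.exp (-x)) / x

/-- What is left of an amplitude once a multiple of the reference one is removed. -/
def profileRem (κ : ℝ) (f : ℝ → ℝ) (x : ℝ) : ℝ := f x - κ * refProfile x

/-- Amplitudes on the half line which behave like `κ / x` at infinity, up to a remainder having an
integrable first moment. -/
structure IsProfile (κ : ℝ) (f : ℝ → ℝ) : Prop where
  rem : IntegrableOn (profileRem κ f) (Set.Ioi 0)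
  mul_rem : IntegrableOn (fun x => x * profileRem κ f x) (Set.Ioi 0)

/-- The Abel regularised cosine transform of an amplitude, in closed form on the reference part. -/
def abelTransform (κ : ℝ) (f : ℝ → ℝ) (t c : ℝ) : ℝ :=
  κ / 2 * Real.log (((1 + t) ^ 2 + c ^ 2) / (t ^ 2 + c ^ 2)) +
    ∫ x in Set.Ioi (0 : ℝ), profileRem κ f x * (Real.exp (-(t * x)) * Real.cos (c * x))

theorem refProfile_nonneg {x : ℝ} (hx : 0 < x) : 0 ≤ refProfile x :=
  div_nonneg (by simpa using hx.le) hx.le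

theorem refProfile_le_one {x : ℝ} (hx : 0 < x) : refProfile x ≤ 1 := by
  rw [refProfile, div_le_one hx]
  linarith [Real.add_one_le_exp (-x)]

theorem mul_refProfile {x : ℝ} (hx : 0 < x) : x * refProfile x = 1 - Real.exp (-x) := by
  rw [refProfile]; field_simp

@[fun_prop]
theorem measurable_refProfile : Measurable refProfile := by
  unfold refProfile; fun_prop

theorem abs_exp_mul_cos_le {t x : ℝ} (ht : 0 ≤ t) (hx : 0 < x) (c : ℝ) :
    |Real.exp (-(t * x)) * Real.cos (c * x)| ≤ 1 := by
  rw [abs_mul, abs_of_pos (Real.exp_pos _)]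
  exact mul_le_one₀ (Real.exp_le_one_iff.2 (by have := mul_nonneg ht hx.le; linarith))
    (abs_nonneg _) (abs_cos_le_one _)

theorem integrableOn_mul_exp_mul_cos {r : ℝ → ℝ} (hr : IntegrableOn r (Set.Ioi 0)) {t : ℝ}
    (ht : 0 ≤ t) (c : ℝ) :
    IntegrableOn (fun x => r x * (Real.exp (-(t * x)) * Real.cos (c * x))) (Set.Ioi 0) := by
  refine Integrable.mul_bdd (c := 1) hr (by fun_prop) ?_
  filter_upwards [ae_restrict_mem measurableSet_Ioi] with x hx
  exact abs_exp_mul_cos_le ht hx c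

theorem integrableOn_refProfile {t : ℝ} (ht : 0 < t) (c : ℝ) :
    IntegrableOn (fun x => refProfile x * (Real.exp (-(t * x)) * Real.cos (c * x)))
      (Set.Ioi 0) := by
  refine Integrable.mono' (exp_neg_integrableOn_Ioi 0 ht) (by fun_prop) ?_
  filter_upwards [ae_restrict_mem measurableSet_Ioi] with x hx
  rw [norm_mul, norm_mul, Real.norm_of_nonneg (refProfile_nonneg hx),
    Real.norm_of_nonneg (Real.exp_pos _).le, neg_mul]
  have h1 := refProfile_le_one hx
  have h2 := abs_cos_le_one (c * x)
  have h3 := refProfile_nonneg hx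
  have h4 := Real.exp_pos (-(t * x))
  rw [Real.norm_eq_abs]
  calc _ ≤ 1 * (Real.exp (-(t * x)) * 1) := by gcongr
    _ = _ := by ring

theorem integral_refProfile {t : ℝ} (ht : 0 < t) (c : ℝ) :
    ∫ x in Set.Ioi (0 : ℝ), refProfile x * (Real.exp (-(t * x)) * Real.cos (c * x)) =
      1 / 2 * Real.log (((1 + t) ^ 2 + c ^ 2) / (t ^ 2 + c ^ 2)) := by
  refine tendsto_nhds_unique
    (intervalIntegral_tendsto_integral_Ioi 0 (integrableOn_refProfile ht c) tendsto_id) ?_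
  refine (tendsto_frullani (α := t) (β := 1 + t) (c := c) (by positivity) ht.le
    (by linarith)).congr fun A => ?_
  apply intervalIntegral.integral_congr
  intro x _
  have : Real.exp (-((1 + t) * x)) = Real.exp (-x) * Real.exp (-(t * x)) := by
    rw [← Real.exp_add]; ring_nf
  simp only [refProfile, this]
  ring

namespace IsProfile

variable {κ κ' : ℝ} {f f' : ℝ → ℝ}

theorem add (hf : IsProfile κ f) (hf' : IsProfile κ' f') :
    IsProfile (κ + κ') (fun x => f x + f' x) := by
  have h : profileRem (κ + κ') (fun x => f x + f' x) =
      fun x => profileRem κ f x + profileRem κ' f' x := by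
    ext x; simp only [profileRem]; ring
  refine ⟨by rw [h]; exact Integrable.add hf.rem hf'.rem, ?_⟩
  simp only [h, mul_add]
  exact Integrable.add hf.mul_rem hf'.mul_rem

theorem const_mul (hf : IsProfile κ f) (a : ℝ) : IsProfile (a * κ) (fun x => a * f x) := by
  have h : profileRem (a * κ) (fun x => a * f x) = fun x => a * profileRem κ f x := by
    ext x; simp only [profileRem]; ring
  refine ⟨by rw [h]; exact Integrable.const_mul hf.rem a, ?_⟩
  simp only [h, mul_left_comm _ a]
  exact Integrable.const_mul hf.mul_rem a

theorem integrableOn (hf : IsProfile κ f) {t : ℝ} (ht : 0 < t) (c : ℝ) :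
    IntegrableOn (fun x => f x * (Real.exp (-(t * x)) * Real.cos (c * x))) (Set.Ioi 0) := by
  have h := Integrable.add (integrableOn_mul_exp_mul_cos hf.rem ht.le c)
    (Integrable.const_mul (integrableOn_refProfile ht c) κ)
  refine h.congr (ae_of_all _ fun x => ?_)
  simp only [Pi.add_apply, profileRem]
  ring

theorem abelTransform_eq (hf : IsProfile κ f) {t : ℝ} (ht : 0 < t) (c : ℝ) :
    abelTransform κ f t c =
      ∫ x in Set.Ioi (0 : ℝ), f x * (Real.exp (-(t * x)) * Real.cos (c * x)) := by
  rw [abelTransform, show κ / 2 = κ * (1 / 2) by ring, mul_assoc, ← integral_refProfile ht c,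
    ← integral_const_mul, ← integral_add (Integrable.const_mul (integrableOn_refProfile ht c) κ)
      (integrableOn_mul_exp_mul_cos hf.rem ht.le c)]
  congr 1
  ext x
  simp only [profileRem]
  ring

/-- Without regularisation the amplitude need not be absolutely integrable. The reference part
converges by Frullani with `α = 0`, where `c ≠ 0` is needed; the remainder converges absolutely. -/
theorem tendsto_integral (hf : IsProfile κ f) {c : ℝ} (hc : c ≠ 0) :
    Tendsto (fun A : ℝ => ∫ x in (0 : ℝ)..A, f x * Real.cos (c * x)) atTop
      (𝓝 (abelTransform κ f 0 c)) := by
  have h1 := (tendsto_frullani (α := 0) (β := 1) (c := c) (by positivity) le_rfl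
    zero_le_one).const_mul κ
  have hr := integrableOn_mul_exp_mul_cos hf.rem le_rfl c
  have h2 := intervalIntegral_tendsto_integral_Ioi 0 hr tendsto_id
  have h3 := h1.add h2
  rw [show κ * (1 / 2 * Real.log ((1 ^ 2 + c ^ 2) / (0 ^ 2 + c ^ 2))) +
    ∫ x in Set.Ioi (0 : ℝ), profileRem κ f x * (Real.exp (-(0 * x)) * Real.cos (c * x)) =
      abelTransform κ f 0 c by rw [abelTransform, add_zero]; ring] at h3
  refine h3.congr' ?_
  filter_upwards [eventually_ge_atTop 0] with A hA
  rw [← intervalIntegral.integral_const_mul, id, ← intervalIntegral.integral_add]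
  · apply intervalIntegral.integral_congr
    intro x _
    simp only [profileRem, refProfile]
    simp
    ring
  · apply IntervalIntegrable.const_mul
    have : IntervalIntegrable (fun _ : ℝ => (1 : ℝ)) volume 0 A := by simp
    refine this.mono_fun' (by fun_prop) ?_
    rw [Set.uIoc_of_le hA]
    filter_upwards [ae_restrict_mem measurableSet_Ioc] with x hx
    have h1 := refProfile_le_one hx.1
    have h2 := refProfile_nonneg hx.1
    simp only [refProfile] at h1 h2
    simp only [zero_mul, neg_zero, Real.exp_zero, one_mul]
    rw [norm_mul, Real.norm_of_nonneg h2, Real.norm_eq_abs]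
    exact mul_le_one₀ h1 (abs_nonneg _) (abs_cos_le_one _)
  · rw [intervalIntegrable_iff_integrableOn_Ioc_of_le hA]
    exact hr.mono_set Set.Ioc_subset_Ioi_self

/-- In the logarithm, the singular denominator only grows with `t`, which is favourable, and the
numerator varies at most like `4 (t - s)`. The remainder varies at most like `t - s` times its first
absolute moment. The loss is thus uniform in `c`, right up to the singularity, and needs only `κ ≥
0`, not a sign of `f`. -/
theorem le_abelTransform_zero (hf : IsProfile κ f) (hκ : 0 ≤ κ) {s t c : ℝ} (hs : 0 ≤ s)
    (hst : s ≤ t) (ht : t ≤ 1) (hc : 0 < s ^ 2 + c ^ 2) :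
    abelTransform κ f t c - (2 * κ + ∫ x in Set.Ioi (0 : ℝ), |x * profileRem κ f x|) * (t - s) ≤
      abelTransform κ f s c := by
  have ht0 : 0 ≤ t := hs.trans hst
  have hsq : s ^ 2 ≤ t ^ 2 := pow_le_pow_left₀ hs hst 2
  have hct : 0 < t ^ 2 + c ^ 2 := by linarith
  have h1 : ∀ u : ℝ, 0 ≤ u → 0 < (1 + u) ^ 2 + c ^ 2 := fun u hu => by positivity
  have hlog : Real.log (((1 + t) ^ 2 + c ^ 2) / (t ^ 2 + c ^ 2)) - 4 * (t - s) ≤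
      Real.log (((1 + s) ^ 2 + c ^ 2) / (s ^ 2 + c ^ 2)) := by
    rw [Real.log_div (h1 t ht0).ne' hct.ne', Real.log_div (h1 s hs).ne' hc.ne']
    have h2 : Real.log (s ^ 2 + c ^ 2) ≤ Real.log (t ^ 2 + c ^ 2) :=
      Real.log_le_log hc (by linarith)
    have h3 : Real.log ((1 + t) ^ 2 + c ^ 2) - Real.log ((1 + s) ^ 2 + c ^ 2) ≤ 4 * (t - s) := by
      rw [← Real.log_div (h1 t ht0).ne' (h1 s hs).ne']
      refine (Real.log_le_sub_one_of_pos (div_pos (h1 t ht0) (h1 s hs))).trans ?_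
      rw [sub_le_iff_le_add, div_le_iff₀ (h1 s hs)]
      have h5 : 1 ≤ (1 + s) ^ 2 + c ^ 2 := by nlinarith [sq_nonneg c]
      have h6 : 0 ≤ t - s := by linarith
      nlinarith [mul_nonneg h6 (sub_nonneg.2 h5)]
    linarith
  have hint : ∫ x in Set.Ioi (0 : ℝ), profileRem κ f x * (Real.exp (-(t * x)) * Real.cos (c * x))
      ≤ (∫ x in Set.Ioi (0 : ℝ), profileRem κ f x * (Real.exp (-(s * x)) * Real.cos (c * x))) +
        (t - s) * ∫ x in Set.Ioi (0 : ℝ), |x * profileRem κ f x| := by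
    rw [← integral_const_mul, ← integral_add (integrableOn_mul_exp_mul_cos hf.rem hs c)
      (Integrable.const_mul hf.mul_rem.abs (t - s))]
    refine setIntegral_mono_on (integrableOn_mul_exp_mul_cos hf.rem ht0 c)
      ((integrableOn_mul_exp_mul_cos hf.rem hs c).add (Integrable.const_mul hf.mul_rem.abs (t - s)))
      measurableSet_Ioi fun x hx => ?_
    have hx : 0 < x := hx
    have he : |Real.exp (-(t * x)) - Real.exp (-(s * x))| ≤ (t - s) * x := by
      have e1 : Real.exp (-(t * x)) = Real.exp (-(s * x)) * Real.exp (-((t - s) * x)) := by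
        rw [← Real.exp_add]; ring_nf
      have e2 : Real.exp (-(s * x)) ≤ 1 := Real.exp_le_one_iff.2 (by nlinarith)
      have e3 := Real.add_one_le_exp (-((t - s) * x))
      have e4 : Real.exp (-((t - s) * x)) ≤ 1 := Real.exp_le_one_iff.2 (by nlinarith)
      have e5 := Real.exp_pos (-(s * x))
      rw [e1, abs_le]
      constructor <;> nlinarith
    have hk : profileRem κ f x * ((Real.exp (-(t * x)) - Real.exp (-(s * x))) * Real.cos (c * x))
        ≤ |profileRem κ f x| * ((t - s) * x * 1) := by
      refine (le_abs_self _).trans ?_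
      rw [abs_mul, abs_mul]
      have := abs_cos_le_one (c * x)
      gcongr
    have : |x * profileRem κ f x| = x * |profileRem κ f x| := by rw [abs_mul, abs_of_pos hx]
    simp only [this]
    nlinarith [hk]
  rw [abelTransform, abelTransform]
  nlinarith [mul_le_mul_of_nonneg_left hlog (by positivity : 0 ≤ κ / 2)]

theorem tendsto_integral_rem (hf : IsProfile κ f) (c : ℝ) :
    Tendsto (fun t => ∫ x in Set.Ioi (0 : ℝ), profileRem κ f x *
      (Real.exp (-(t * x)) * Real.cos (c * x))) (𝓝[≥] 0)
      (𝓝 (∫ x in Set.Ioi (0 : ℝ), profileRem κ f x *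
        (Real.exp (-(0 * x)) * Real.cos (c * x)))) := by
  refine tendsto_integral_filter_of_dominated_convergence (fun x => |profileRem κ f x|) ?_ ?_
    hf.rem.abs ?_
  · filter_upwards [self_mem_nhdsWithin] with t ht
    exact (integrableOn_mul_exp_mul_cos hf.rem ht c).1
  · filter_upwards [self_mem_nhdsWithin] with t ht
    filter_upwards [ae_restrict_mem measurableSet_Ioi] with x hx
    rw [norm_mul]
    exact mul_le_of_le_one_right (norm_nonneg _) (abs_exp_mul_cos_le ht hx c)
  · refine ae_of_all _ fun x => ?_
    have : Continuous fun t : ℝ => profileRem κ f x * (Real.exp (-(t * x)) * Real.cos (c * x)) := by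
      fun_prop
    exact (this.tendsto 0).mono_left nhdsWithin_le_nhds

theorem tendsto_abelTransform (hf : IsProfile κ f) {c : ℝ} (hc : c ≠ 0) :
    Tendsto (fun t => abelTransform κ f t c) (𝓝[≥] 0) (𝓝 (abelTransform κ f 0 c)) := by
  refine Tendsto.add ?_ (hf.tendsto_integral_rem c)
  have : ContinuousAt (fun t : ℝ =>
      κ / 2 * Real.log (((1 + t) ^ 2 + c ^ 2) / (t ^ 2 + c ^ 2))) 0 := by
    refine ContinuousAt.const_mul (ContinuousAt.log (ContinuousAt.div (by fun_prop) (by fun_prop)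
      ?_) ?_) _
    · simpa using hc
    · have : 0 < ((1 + 0) ^ 2 + c ^ 2) / (0 ^ 2 + c ^ 2) := by positivity
      exact this.ne'
  exact this.tendsto.mono_left nhdsWithin_le_nhds

theorem tendsto_abelTransform_atTop (hf : IsProfile κ f) (hκ : 0 < κ) :
    Tendsto (fun t => abelTransform κ f t 0) (𝓝[>] 0) atTop := by
  have h2 := (hf.tendsto_integral_rem 0).mono_left
    (nhdsWithin_mono 0 (Set.Ioi_subset_Ici_self : Set.Ioi (0 : ℝ) ⊆ Set.Ici 0))
  refine Tendsto.atTop_add ?_ h2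
  refine Tendsto.const_mul_atTop (by positivity) (Real.tendsto_log_atTop.comp ?_)
  have h3 : Tendsto (fun t : ℝ => t⁻¹) (𝓝[>] 0) atTop := tendsto_inv_nhdsGT_zero
  refine tendsto_atTop_mono' _ ?_ h3
  filter_upwards [Ioo_mem_nhdsGT (zero_lt_one (α := ℝ))] with t ht
  obtain ⟨h0, h1⟩ := ht
  rw [inv_eq_one_div, div_le_div_iff₀ h0 (by positivity)]
  nlinarith

theorem continuous_abelTransform (hf : IsProfile κ f) {t : ℝ} (ht : 0 < t) :
    Continuous (fun c => abelTransform κ f t c) := by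
  refine Continuous.add ?_ ?_
  · refine continuous_const.mul (Continuous.log (Continuous.div (by fun_prop) (by fun_prop)
      fun c => ?_) fun c => ?_) <;> positivity
  · refine continuous_of_dominated (bound := fun x => |profileRem κ f x|)
      (fun c => (integrableOn_mul_exp_mul_cos hf.rem ht.le c).1) (fun c => ?_) hf.rem.abs ?_
    · filter_upwards [ae_restrict_mem measurableSet_Ioi] with x hx
      rw [norm_mul]
      exact mul_le_of_le_one_right (norm_nonneg _) (abs_exp_mul_cos_le ht.le hx c)
    · exact ae_of_all _ fun x => by fun_prop

end IsProfile

theorem abelTransform_add {κ κ' : ℝ} {f f' : ℝ → ℝ} (hf : IsProfile κ f) (hf' : IsProfile κ' f')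
    {t : ℝ} (ht : 0 ≤ t) (c : ℝ) :
    abelTransform (κ + κ') (fun x => f x + f' x) t c =
      abelTransform κ f t c + abelTransform κ' f' t c := by
  have h : ∀ x, profileRem (κ + κ') (fun x => f x + f' x) x *
      (Real.exp (-(t * x)) * Real.cos (c * x)) =
      profileRem κ f x * (Real.exp (-(t * x)) * Real.cos (c * x)) +
        profileRem κ' f' x * (Real.exp (-(t * x)) * Real.cos (c * x)) := by
    intro x; simp only [profileRem]; ring
  simp only [abelTransform, h]
  rw [integral_add (integrableOn_mul_exp_mul_cos hf.rem ht c)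
    (integrableOn_mul_exp_mul_cos hf'.rem ht c)]
  ring

theorem abelTransform_const_mul (κ a : ℝ) (f : ℝ → ℝ) (t c : ℝ) :
    abelTransform (a * κ) (fun x => a * f x) t c = a * abelTransform κ f t c := by
  have h : ∀ x, profileRem (a * κ) (fun x => a * f x) x *
      (Real.exp (-(t * x)) * Real.cos (c * x)) =
      a * (profileRem κ f x * (Real.exp (-(t * x)) * Real.cos (c * x))) := by
    intro x; simp only [profileRem]; ring
  simp only [abelTransform, h, integral_const_mul]
  ring

/-! ### The two amplitudes: positivity and decay. -/

/-- The amplitude of `ln c` on the half line. -/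
def crossAmplitude (b x : ℝ) : ℝ :=
  (1 - Real.exp (-(2 * b * x))) * (1 - Real.exp (-((1 - 2 * b) * x))) /
    (x * (1 - Real.exp (-x)))

/-- The amplitude of `-𝔴⁽⁺⁾` on the half line. -/
def plusAmplitude (b x : ℝ) : ℝ :=
  1 / 2 * crossAmplitude b x * ((1 - Real.exp (-x)) / (1 + Real.exp (-x))) ^ 2

@[fun_prop]
theorem measurable_crossAmplitude (b : ℝ) : Measurable (crossAmplitude b) := by
  unfold crossAmplitude; fun_prop

@[fun_prop]
theorem measurable_plusAmplitude (b : ℝ) : Measurable (plusAmplitude b) := by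
  unfold plusAmplitude; fun_prop

/-- The remainder is at most `1` for `x ≤ 1`, and there `exp (1 - x) ≥ 1` dominates it; for `x > 1`
the bound on `x` times the remainder is stronger than needed. That same bound gives the first
moment. -/
theorem isProfile_of_le {κ β γ : ℝ} {f : ℝ → ℝ} (hκ : κ ≤ 1) (hβ : 0 < β) (hγ : 0 < γ)
    (hf : Measurable f) (hle : ∀ x, 0 < x → 0 ≤ f x ∧ f x ≤ κ * refProfile x)
    (hx : ∀ x, 0 < x →
      x * (κ * refProfile x - f x) ≤ Real.exp (-(β * x)) + Real.exp (-(γ * x))) :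
    IsProfile κ f := by
  have hm : Measurable (profileRem κ f) := by
    unfold profileRem; fun_prop
  have hPQ : IntegrableOn (fun x => Real.exp (-(β * x)) + Real.exp (-(γ * x))) (Set.Ioi 0) := by
    have h := Integrable.add (exp_neg_integrableOn_Ioi 0 hβ) (exp_neg_integrableOn_Ioi 0 hγ)
    simp only [neg_mul] at h
    exact h
  have habs : ∀ x, 0 < x → |profileRem κ f x| = κ * refProfile x - f x := by
    intro x hx
    rw [profileRem, abs_of_nonpos (by linarith [(hle x hx).2])]
    ring
  constructor
  · have h1 : IntegrableOn (fun x => Real.exp 1 * Real.exp (-1 * x)) (Set.Ioi 0) :=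
      Integrable.const_mul (exp_neg_integrableOn_Ioi 0 one_pos) _
    refine Integrable.mono' (Integrable.add h1 hPQ) hm.aestronglyMeasurable ?_
    filter_upwards [ae_restrict_mem measurableSet_Ioi] with x hx0
    have hx0 : 0 < x := hx0
    rw [Real.norm_eq_abs, habs x hx0, Pi.add_apply, ← Real.exp_add]
    have e1 := Real.exp_pos (-(β * x))
    have e2 := Real.exp_pos (-(γ * x))
    rcases le_or_gt x 1 with h | h
    · have : 1 ≤ Real.exp (1 + -1 * x) := Real.one_le_exp (by linarith)
      have h3 := refProfile_le_one hx0
      have h4 := refProfile_nonneg hx0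
      nlinarith [(hle x hx0).1]
    · have := Real.exp_pos (1 + -1 * x)
      nlinarith [(hle x hx0).2, hx x hx0]
  · refine Integrable.mono' hPQ (measurable_id.mul hm).aestronglyMeasurable ?_
    filter_upwards [ae_restrict_mem measurableSet_Ioi] with x hx0
    have hx0 : 0 < x := hx0
    rw [Real.norm_eq_abs, abs_mul, abs_of_pos hx0, habs x hx0]
    exact hx x hx0

section Bounds

variable {b x : ℝ}

theorem exp_two_mul_mul_exp (b x : ℝ) :
    Real.exp (-(2 * b * x)) * Real.exp (-((1 - 2 * b) * x)) = Real.exp (-x) := by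
  rw [← Real.exp_add]; ring_nf

theorem exp_two_mul_lt_one (hb : 0 < b) (hx : 0 < x) : Real.exp (-(2 * b * x)) < 1 := by
  rw [Real.exp_lt_one_iff]; have := mul_pos hb hx; nlinarith

theorem exp_one_sub_lt_one (hb' : b < 1 / 2) (hx : 0 < x) :
    Real.exp (-((1 - 2 * b) * x)) < 1 := by
  rw [Real.exp_lt_one_iff]
  have : 0 < 1 - 2 * b := by linarith
  have := mul_pos this hx
  linarith

theorem exp_neg_lt_one (hx : 0 < x) : Real.exp (-x) < 1 := by
  rw [Real.exp_lt_one_iff]; linarith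

theorem crossAmplitude_pos (hb : 0 < b) (hb' : b < 1 / 2) (hx : 0 < x) :
    0 < crossAmplitude b x := by
  have h1 := exp_two_mul_lt_one hb hx
  have h2 := exp_one_sub_lt_one hb' hx
  have h3 := exp_neg_lt_one hx
  exact div_pos (mul_pos (by linarith) (by linarith)) (mul_pos hx (by linarith))

theorem plusAmplitude_pos (hb : 0 < b) (hb' : b < 1 / 2) (hx : 0 < x) :
    0 < plusAmplitude b x := by
  have h1 := crossAmplitude_pos hb hb' hx
  have h3 := exp_neg_lt_one hx
  have h4 := Real.exp_pos (-x)
  have : 0 < (1 - Real.exp (-x)) / (1 + Real.exp (-x)) := div_pos (by linarith) (by linarith)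
  unfold plusAmplitude
  positivity

theorem mul_crossAmplitude (hx : 0 < x) :
    x * crossAmplitude b x = (1 - Real.exp (-(2 * b * x))) *
      (1 - Real.exp (-((1 - 2 * b) * x))) / (1 - Real.exp (-x)) := by
  unfold crossAmplitude
  field_simp

theorem crossAmplitude_le (hb : 0 < b) (hb' : b < 1 / 2) (hx : 0 < x) :
    crossAmplitude b x ≤ refProfile x := by
  refine le_of_mul_le_mul_left ?_ hx
  have h1 := exp_two_mul_lt_one hb hx
  have h2 := exp_one_sub_lt_one hb' hx
  have h3 := exp_neg_lt_one hx
  have h4 := exp_two_mul_mul_exp b x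
  have h5 := Real.exp_pos (-(2 * b * x))
  have h6 := Real.exp_pos (-((1 - 2 * b) * x))
  rw [mul_crossAmplitude hx, mul_refProfile hx, div_le_iff₀ (by linarith), ← h4]
  have h7 : Real.exp (-(2 * b * x)) * Real.exp (-((1 - 2 * b) * x)) ≤ Real.exp (-(2 * b * x)) := by
    nlinarith
  have h8 : Real.exp (-(2 * b * x)) * Real.exp (-((1 - 2 * b) * x)) ≤
    Real.exp (-((1 - 2 * b) * x)) := by nlinarith
  apply mul_le_mul <;> linarith

theorem mul_refProfile_sub_crossAmplitude_le (hb : 0 < b) (hb' : b < 1 / 2) (hx : 0 < x) :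
    x * (refProfile x - crossAmplitude b x) ≤
      Real.exp (-(2 * b * x)) + Real.exp (-((1 - 2 * b) * x)) := by
  have h1 := exp_two_mul_lt_one hb hx
  have h2 := exp_one_sub_lt_one hb' hx
  have h3 := exp_neg_lt_one hx
  have h4 := exp_two_mul_mul_exp b x
  rw [mul_sub, mul_crossAmplitude hx, mul_refProfile hx]
  have h9 : (1 - Real.exp (-(2 * b * x))) * (1 - Real.exp (-((1 - 2 * b) * x))) ≤
      (1 - Real.exp (-(2 * b * x))) * (1 - Real.exp (-((1 - 2 * b) * x))) / (1 - Real.exp (-x)) :=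
    le_div_self (mul_nonneg (by linarith) (by linarith)) (by linarith)
      (by linarith [Real.exp_pos (-x)])
  have h10 := Real.exp_pos (-x)
  nlinarith

theorem plusAmplitude_le_crossAmplitude (hb : 0 < b) (hb' : b < 1 / 2) (hx : 0 < x) :
    plusAmplitude b x ≤ 1 / 2 * crossAmplitude b x := by
  have h1 := crossAmplitude_pos hb hb' hx
  have h3 := exp_neg_lt_one hx
  have h4 := Real.exp_pos (-x)
  unfold plusAmplitude
  refine mul_le_of_le_one_right (by positivity) ?_
  refine pow_le_one₀ (div_nonneg (by linarith) (by linarith)) ?_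
  rw [div_le_one (by linarith)]
  linarith

theorem plusAmplitude_le (hb : 0 < b) (hb' : b < 1 / 2) (hx : 0 < x) :
    plusAmplitude b x ≤ 1 / 2 * refProfile x := by
  linarith [plusAmplitude_le_crossAmplitude hb hb' hx, crossAmplitude_le hb hb' hx]

theorem mul_refProfile_sub_plusAmplitude_le (hb : 0 < b) (hb' : b < 1 / 2) (hx : 0 < x) :
    x * (1 / 2 * refProfile x - plusAmplitude b x) ≤
      2 * (Real.exp (-(2 * b * x)) + Real.exp (-((1 - 2 * b) * x))) := by
  have h0 := mul_refProfile_sub_crossAmplitude_le hb hb' hx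
  have h1 := crossAmplitude_pos hb hb' hx
  have h3 := exp_neg_lt_one hx
  have h4 := Real.exp_pos (-x)
  have h5 := exp_two_mul_lt_one hb hx
  have h6 := exp_two_mul_mul_exp b x
  have h7 := Real.exp_pos (-((1 - 2 * b) * x))
  have hE : Real.exp (-x) ≤ Real.exp (-((1 - 2 * b) * x)) := by nlinarith
  have h8 : x * crossAmplitude b x ≤ 1 := by
    have h9 := mul_le_mul_of_nonneg_left (crossAmplitude_le hb hb' hx) hx.le
    rw [mul_refProfile hx] at h9
    linarith
  -- The factor separating `plusAmplitude` from half of `crossAmplitude` is `tanh² (x / 2)`,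
  -- exponentially close to `1`.
  have h10 : 1 - 4 * Real.exp (-x) ≤ ((1 - Real.exp (-x)) / (1 + Real.exp (-x))) ^ 2 := by
    rw [div_pow, le_div_iff₀ (by positivity)]
    nlinarith [pow_pos h4 2, pow_pos h4 3]
  have h11 : 0 < x * crossAmplitude b x := mul_pos hx h1
  have h12 : x * plusAmplitude b x ≥ 1 / 2 * (x * crossAmplitude b x) * (1 - 4 * Real.exp (-x)) := by
    have : x * plusAmplitude b x = 1 / 2 * (x * crossAmplitude b x) *
      ((1 - Real.exp (-x)) / (1 + Real.exp (-x))) ^ 2 := by unfold plusAmplitude; ring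
    rw [this]
    exact mul_le_mul_of_nonneg_left h10 (by linarith)
  have h13 := Real.exp_pos (-(2 * b * x))
  nlinarith

end Bounds

theorem isProfile_crossAmplitude {b : ℝ} (hb : 0 < b) (hb' : b < 1 / 2) :
    IsProfile 1 (crossAmplitude b) := by
  refine isProfile_of_le (β := 2 * b) (γ := 1 - 2 * b) le_rfl (by linarith) (by linarith)
    (by fun_prop) (fun x hx => ⟨(crossAmplitude_pos hb hb' hx).le, ?_⟩) fun x hx => ?_
  · simpa using crossAmplitude_le hb hb' hx
  · simpa using mul_refProfile_sub_crossAmplitude_le hb hb' hx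

theorem isProfile_plusAmplitude {b : ℝ} (hb : 0 < b) (hb' : b < 1 / 2) :
    IsProfile (1 / 2) (plusAmplitude b) := by
  -- Halving the amplitude absorbs the factor `2` in `mul_refProfile_sub_plusAmplitude_le`; it is
  -- undone by `const_mul 2`.
  have h : IsProfile (1 / 4) (fun x => 1 / 2 * plusAmplitude b x) := by
    refine isProfile_of_le (β := 2 * b) (γ := 1 - 2 * b) (by norm_num) (by linarith) (by linarith)
      (by fun_prop) (fun x hx => ⟨?_, ?_⟩) fun x hx => ?_
    · have := plusAmplitude_pos hb hb' hx; positivity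
    · linarith [plusAmplitude_le hb hb' hx]
    · linarith [mul_refProfile_sub_plusAmplitude_le hb hb' hx]
  convert h.const_mul 2 using 1
  · norm_num
  · ext x; ring

/-! ### Euler product and Fourier representation of `ln c`. -/

/-- The `n`-th factor of the Euler product of `c (π c)`. -/
def eulerFactor (b c : ℝ) (n : ℕ) : ℝ :=
  (((n + 2 * b) ^ 2 + c ^ 2) / ((n : ℝ) ^ 2 + c ^ 2)) *
    (((n + 1 - 2 * b) ^ 2 + c ^ 2) / (((n + 1 : ℝ)) ^ 2 + c ^ 2))

theorem normSq_one_sub_sq_div (a c : ℝ) (n : ℕ) :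
    Complex.normSq (1 - ((a : ℂ) + c * Complex.I) ^ 2 / ((n : ℂ) + 1) ^ 2) =
      ((n + 1 - a) ^ 2 + c ^ 2) * ((n + 1 + a) ^ 2 + c ^ 2) / ((n + 1 : ℝ) ^ 2) ^ 2 := by
  have h0 : ((n : ℂ) + 1) ≠ 0 := Nat.cast_add_one_ne_zero n
  have h : (1 - ((a : ℂ) + c * Complex.I) ^ 2 / ((n : ℂ) + 1) ^ 2) =
      (((n + 1 - a : ℝ) : ℂ) + ((-c : ℝ) : ℂ) * Complex.I) *
        (((n + 1 + a : ℝ) : ℂ) + (c : ℂ) * Complex.I) / (((n + 1 : ℝ) ^ 2 : ℝ) : ℂ) := by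
    push_cast
    field_simp
    ring
  rw [h, Complex.normSq_div, Complex.normSq_mul, Complex.normSq_add_mul_I,
    Complex.normSq_add_mul_I, Complex.normSq_ofReal]
  ring

theorem normSq_sin_add_mul_I (a y : ℝ) :
    Complex.normSq (Complex.sin ((a : ℂ) + y * Complex.I)) =
      Real.sin a ^ 2 + Real.sinh y ^ 2 := by
  rw [Complex.sin_add_mul_I, ← Complex.ofReal_sin, ← Complex.ofReal_cos, ← Complex.ofReal_sinh,
    ← Complex.ofReal_cosh, ← Complex.ofReal_mul, ← Complex.ofReal_mul, Complex.normSq_add_mul_I,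
    mul_pow, mul_pow, Real.cosh_sq]
  nlinarith [Real.sin_sq_add_cos_sq a]

/-- This is the squared modulus of Euler's product for the sine at `a + i c`, with `|sin (a + i y)|²
= sin² a + sinh² y`. -/
theorem tendsto_prod_normSq (a c : ℝ) :
    Tendsto (fun M : ℕ => π ^ 2 * (a ^ 2 + c ^ 2) * ∏ n ∈ Finset.range M,
      (((n + 1 - a) ^ 2 + c ^ 2) * ((n + 1 + a) ^ 2 + c ^ 2) / ((n + 1 : ℝ) ^ 2) ^ 2)) atTop
      (𝓝 (Real.sin (π * a) ^ 2 + Real.sinh (π * c) ^ 2)) := by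
  have h := (Complex.continuous_normSq.tendsto _).comp
    (Complex.tendsto_euler_sin_prod ((a : ℂ) + c * Complex.I))
  rw [show (π : ℂ) * ((a : ℂ) + c * Complex.I) =
    ((π * a : ℝ) : ℂ) + ((π * c : ℝ) : ℂ) * Complex.I by push_cast; ring,
    normSq_sin_add_mul_I] at h
  refine h.congr fun M => ?_
  simp only [Function.comp, Complex.normSq_mul, map_prod, normSq_one_sub_sq_div,
    Complex.normSq_add_mul_I]
  ring

/-- The Euler factors pair `n + 2b` with `n + 1 - 2b`, whereas the sine product pairs `n + 1 + 2b`
with `n + 1 - 2b`. The shift by one produces the prefactor and the last quotient, which tends to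
`1`. -/
theorem prod_eulerFactor {b c : ℝ} (hb : 0 < b) (hc : c ≠ 0) (M : ℕ) :
    ∏ n ∈ Finset.range M, eulerFactor b c n =
      (π ^ 2 * ((2 * b) ^ 2 + c ^ 2) * ∏ n ∈ Finset.range M,
        (((n + 1 - 2 * b) ^ 2 + c ^ 2) * ((n + 1 + 2 * b) ^ 2 + c ^ 2) / ((n + 1 : ℝ) ^ 2) ^ 2)) /
      (π ^ 2 * (0 ^ 2 + c ^ 2) * ∏ n ∈ Finset.range M,
        (((n + 1 - 0) ^ 2 + c ^ 2) * ((n + 1 + 0) ^ 2 + c ^ 2) / ((n + 1 : ℝ) ^ 2) ^ 2)) *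
      (((M : ℝ) ^ 2 + c ^ 2) / ((M + 2 * b) ^ 2 + c ^ 2)) := by
  have hc2 : 0 < c ^ 2 := by positivity
  induction M with
  | zero =>
    simp only [Finset.range_zero, Finset.prod_empty, Nat.cast_zero]
    field_simp
    ring_nf
  | succ M ih =>
    have hP : ∀ a : ℝ, ∏ n ∈ Finset.range M,
        (((n + 1 - a) ^ 2 + c ^ 2) * ((n + 1 + a) ^ 2 + c ^ 2) / ((n + 1 : ℝ) ^ 2) ^ 2) ≠ 0 :=
      fun a => (Finset.prod_pos fun n _ => by positivity).ne'
    rw [Finset.prod_range_succ, Finset.prod_range_succ, Finset.prod_range_succ, ih, eulerFactor]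
    have h1 := hP (2 * b)
    have h2 := hP 0
    generalize (∏ n ∈ Finset.range M, (((n + 1 - 2 * b) ^ 2 + c ^ 2) *
      ((n + 1 + 2 * b) ^ 2 + c ^ 2) / ((n + 1 : ℝ) ^ 2) ^ 2)) = p1 at *
    generalize (∏ n ∈ Finset.range M, (((n + 1 - (0 : ℝ)) ^ 2 + c ^ 2) *
      ((n + 1 + 0) ^ 2 + c ^ 2) / ((n + 1 : ℝ) ^ 2) ^ 2)) = p2 at *
    push_cast
    have e1 : 0 < (M : ℝ) ^ 2 + c ^ 2 := by positivity
    have e2 : 0 < ((M : ℝ) + 2 * b) ^ 2 + c ^ 2 := by positivity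
    have e3 : 0 < ((M : ℝ) + 1 + 2 * b) ^ 2 + c ^ 2 := by positivity
    have e4 : 0 < ((M : ℝ) + 1) ^ 2 + c ^ 2 := by positivity
    have e5 : (0 : ℝ) ^ 2 + c ^ 2 = c ^ 2 := by ring
    rw [e5, sub_zero, add_zero]
    field_simp

theorem tendsto_prod_eulerFactor {b c : ℝ} (hb : 0 < b) (hc : c ≠ 0) :
    Tendsto (fun M : ℕ => ∏ n ∈ Finset.range M, eulerFactor b c n) atTop
      (𝓝 ((Real.sin (π * (2 * b)) ^ 2 + Real.sinh (π * c) ^ 2) / Real.sinh (π * c) ^ 2)) := by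
  have hs : Real.sinh (π * c) ≠ 0 := by
    rw [Ne, Real.sinh_eq_zero]; exact mul_ne_zero Real.pi_ne_zero hc
  have h0 := tendsto_prod_normSq 0 c
  rw [mul_zero, Real.sin_zero, zero_pow two_ne_zero, zero_add, zero_add] at h0
  have h1 := (tendsto_prod_normSq (2 * b) c).div h0 (by positivity)
  have h2 : Tendsto (fun M : ℕ => ((M : ℝ) ^ 2 + c ^ 2) / ((M + 2 * b) ^ 2 + c ^ 2)) atTop
      (𝓝 1) := by
    have h3 : Tendsto (fun M : ℕ => (1 + c ^ 2 * ((M : ℝ)⁻¹) ^ 2) /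
        ((1 + 2 * b * (M : ℝ)⁻¹) ^ 2 + c ^ 2 * ((M : ℝ)⁻¹) ^ 2)) atTop
        (𝓝 ((1 + c ^ 2 * 0 ^ 2) / ((1 + 2 * b * 0) ^ 2 + c ^ 2 * 0 ^ 2))) := by
      have h4 : Tendsto (fun M : ℕ => ((M : ℝ))⁻¹) atTop (𝓝 0) := tendsto_inv_atTop_nhds_zero_nat
      refine Tendsto.div (((h4.pow 2).const_mul _).const_add _)
        ((((h4.const_mul _).const_add _).pow 2).add ((h4.pow 2).const_mul _)) (by norm_num)
    norm_num at h3
    refine h3.congr' ?_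
    filter_upwards [eventually_gt_atTop 0] with M hM
    have : (0 : ℝ) < M := by exact_mod_cast hM
    field_simp
  have h5 := h1.mul h2
  rw [mul_one] at h5
  refine h5.congr fun M => ?_
  rw [prod_eulerFactor hb hc, zero_pow two_ne_zero, zero_add]
  rfl

/-- Expanding `1 / (1 - exp (-x))` in a geometric series truncated at `M` turns the amplitude into
Frullani quotients, one pair for each Euler factor. -/
theorem crossAmplitude_mul_one_sub {b x : ℝ} (hx : 0 < x) (M : ℕ) :
    crossAmplitude b x * (1 - Real.exp (-(M * x))) = ∑ n ∈ Finset.range M,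
      ((Real.exp (-(n * x)) - Real.exp (-((n + 2 * b) * x))) / x -
        (Real.exp (-((n + 1 - 2 * b) * x)) - Real.exp (-((n + 1 : ℝ) * x))) / x) := by
  have hE := exp_neg_lt_one hx
  have h1 : ∀ n : ℕ, Real.exp (-((n : ℝ) * x)) = Real.exp (-x) ^ n := by
    intro n; rw [← Real.exp_nat_mul]; ring_nf
  have h2 : ∀ n : ℕ, ((Real.exp (-(n * x)) - Real.exp (-((n + 2 * b) * x))) / x -
        (Real.exp (-((n + 1 - 2 * b) * x)) - Real.exp (-((n + 1 : ℝ) * x))) / x) =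
      Real.exp (-x) ^ n * ((1 - Real.exp (-(2 * b * x))) *
        (1 - Real.exp (-((1 - 2 * b) * x))) / x) := by
    intro n
    have e1 : Real.exp (-((n + 2 * b) * x)) = Real.exp (-x) ^ n * Real.exp (-(2 * b * x)) := by
      rw [← h1, ← Real.exp_add]; ring_nf
    have e2 : Real.exp (-((n + 1 - 2 * b) * x)) =
        Real.exp (-x) ^ n * Real.exp (-((1 - 2 * b) * x)) := by
      rw [← h1, ← Real.exp_add]; ring_nf
    have e3 : Real.exp (-((n + 1 : ℝ) * x)) = Real.exp (-x) ^ n * Real.exp (-x) := by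
      rw [← h1, ← Real.exp_add]; ring_nf
    rw [e1, e2, e3, h1, ← exp_two_mul_mul_exp b x]
    ring
  rw [Finset.sum_congr rfl fun n _ => h2 n, ← Finset.sum_mul, geom_sum_eq hE.ne, h1,
    crossAmplitude]
  have h3 : 1 - Real.exp (-x) ≠ 0 := by linarith
  have h4 : Real.exp (-x) - 1 ≠ 0 := by linarith
  field_simp
  ring

theorem IsProfile.intervalIntegrable {κ : ℝ} {f : ℝ → ℝ} (hf : IsProfile κ f) (c : ℝ) {A : ℝ}
    (hA : 0 ≤ A) : IntervalIntegrable (fun x => f x * Real.cos (c * x)) volume 0 A := by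
  have h1 : IntervalIntegrable (fun x => f x * (Real.exp (-(1 * x)) * Real.cos (c * x)))
      volume 0 A := by
    rw [intervalIntegrable_iff_integrableOn_Ioc_of_le hA]
    exact (hf.integrableOn one_pos c).mono_set Set.Ioc_subset_Ioi_self
  have h2 := h1.mul_continuousOn (g := fun x => Real.exp x) (by fun_prop)
  refine h2.congr (fun x _ => ?_)
  have : Real.exp (-(1 * x)) * Real.exp x = 1 := by rw [← Real.exp_add]; simp
  linear_combination (f x * Real.cos (c * x)) * this

/-- Integrating the truncated geometric series gives the logarithm of the partial Euler product, and
the tail is exactly the Abel transform at `t = M`, which is at most `1 / M` in modulus. -/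
theorem two_mul_abelTransform_crossAmplitude_eq {b c : ℝ} (hb : 0 < b) (hb' : b < 1 / 2)
    (hc : c ≠ 0) {M : ℕ} (hM : 0 < M) :
    2 * abelTransform 1 (crossAmplitude b) 0 c =
      Real.log (∏ n ∈ Finset.range M, eulerFactor b c n) +
        2 * abelTransform 1 (crossAmplitude b) M c := by
  have hf := isProfile_crossAmplitude hb hb'
  have hM' : (0 : ℝ) < M := by exact_mod_cast hM
  have hc2 : 0 < c ^ 2 := by positivity
  have h1 := hf.tendsto_integral hc
  have hexp := hf.integrableOn hM' c
  have h2 := intervalIntegral_tendsto_integral_Ioi 0 hexp tendsto_id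
  rw [← hf.abelTransform_eq hM' c] at h2
  have hF1 : ∀ n : ℕ, Tendsto (fun A : ℝ => ∫ x in (0 : ℝ)..A,
      (Real.exp (-(n * x)) - Real.exp (-((n + 2 * b) * x))) / x * Real.cos (c * x)) atTop
      (𝓝 (1 / 2 * Real.log (((n + 2 * b) ^ 2 + c ^ 2) / ((n : ℝ) ^ 2 + c ^ 2)))) :=
    fun n => tendsto_frullani (by positivity) (by positivity) (by linarith)
  have hF2 : ∀ n : ℕ, Tendsto (fun A : ℝ => ∫ x in (0 : ℝ)..A,
      (Real.exp (-((n + 1 - 2 * b) * x)) - Real.exp (-((n + 1 : ℝ) * x))) / x * Real.cos (c * x))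
      atTop (𝓝 (1 / 2 * Real.log (((n + 1 : ℝ) ^ 2 + c ^ 2) / ((n + 1 - 2 * b) ^ 2 + c ^ 2)))) :=
    fun n => tendsto_frullani (by positivity)
      (by have : (0 : ℝ) ≤ n := n.cast_nonneg
          linarith) (by linarith)
  have h3 := (tendsto_finsetSum (Finset.range M) fun n _ => (hF1 n).sub (hF2 n)).add h2
  have h4 := tendsto_nhds_unique h1 (h3.congr' ?_)
  · rw [h4, mul_add, Finset.mul_sum, Real.log_prod]
    · congr 1
      refine Finset.sum_congr rfl fun n _ => ?_
      rw [eulerFactor, Real.log_mul (by positivity) (by positivity),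
        ← inv_div ((n + 1 - 2 * b) ^ 2 + c ^ 2) ((n + 1 : ℝ) ^ 2 + c ^ 2), Real.log_inv]
      ring
    · intro n _
      unfold eulerFactor
      positivity
  -- The quotient has a removable singularity at the origin: it agrees almost everywhere with a
  -- continuous parametric integral.
  · have hint : ∀ α β A : ℝ, 0 ≤ α → α ≤ β → IntervalIntegrable
        (fun x => (Real.exp (-(α * x)) - Real.exp (-(β * x))) / x * Real.cos (c * x))
        volume 0 A := by
      intro α β A hα hβ
      have hcont : Continuous fun x : ℝ =>
          (∫ y in α..β, Real.exp (-(y * x))) * Real.cos (c * x) := by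
        refine Continuous.mul ?_ (by fun_prop)
        exact intervalIntegral.continuous_parametric_intervalIntegral_of_continuous' (by fun_prop)
          _ _
      refine (hcont.intervalIntegrable 0 A).congr_ae ?_
      have : ∀ᵐ x : ℝ, x ≠ 0 := by simp [ae_iff]
      filter_upwards [ae_restrict_of_ae this] with x hx
      rw [integral_exp_mul_interval hx]
    filter_upwards [eventually_ge_atTop 0] with A hA
    have hI1 : ∀ n : ℕ, IntervalIntegrable (fun x => (Real.exp (-(n * x)) -
        Real.exp (-((n + 2 * b) * x))) / x * Real.cos (c * x)) volume 0 A :=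
      fun n => hint _ _ _ (by positivity) (by linarith)
    have hI2 : ∀ n : ℕ, IntervalIntegrable (fun x => (Real.exp (-((n + 1 - 2 * b) * x)) -
        Real.exp (-((n + 1 : ℝ) * x))) / x * Real.cos (c * x)) volume 0 A :=
      fun n => hint _ _ _ (by have : (0 : ℝ) ≤ n := n.cast_nonneg
                              linarith) (by linarith)
    simp only [id]
    rw [Finset.sum_congr rfl fun n _ => (intervalIntegral.integral_sub (hI1 n) (hI2 n)).symm,
      ← intervalIntegral.integral_finsetSum (fun n _ => (hI1 n).sub (hI2 n)),
      ← intervalIntegral.integral_add]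
    · apply intervalIntegral.integral_congr_ae
      refine ae_of_all _ fun x hx => ?_
      rw [Set.uIoc_of_le hA] at hx
      have h6 := crossAmplitude_mul_one_sub (b := b) hx.1 M
      have h7 : ∑ n ∈ Finset.range M, ((Real.exp (-(n * x)) - Real.exp (-((n + 2 * b) * x))) / x *
          Real.cos (c * x) - (Real.exp (-((n + 1 - 2 * b) * x)) - Real.exp (-((n + 1 : ℝ) * x))) / x
            * Real.cos (c * x)) = crossAmplitude b x * (1 - Real.exp (-(M * x))) *
              Real.cos (c * x) := by
        rw [h6, Finset.sum_mul]
        exact Finset.sum_congr rfl fun n _ => by ring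
      rw [h7]
      ring
    · have h8 := IntervalIntegrable.sum (Finset.range M) fun n _ => (hI1 n).sub (hI2 n)
      refine h8.congr fun x _ => ?_
      simp only [Finset.sum_apply]
    · rw [intervalIntegrable_iff_integrableOn_Ioc_of_le hA]
      exact hexp.mono_set Set.Ioc_subset_Ioi_self

theorem abs_abelTransform_crossAmplitude_le {b : ℝ} (hb : 0 < b) (hb' : b < 1 / 2) {t : ℝ}
    (ht : 0 < t) (c : ℝ) : |abelTransform 1 (crossAmplitude b) t c| ≤ 1 / t := by
  rw [(isProfile_crossAmplitude hb hb').abelTransform_eq ht c]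
  have h1 : ∫ x in Set.Ioi (0 : ℝ), Real.exp (-t * x) = 1 / t := by
    rw [integral_exp_mul_Ioi (by linarith)]; simp [neg_div_neg_eq]
  rw [← h1, ← Real.norm_eq_abs]
  refine norm_integral_le_of_norm_le (exp_neg_integrableOn_Ioi 0 ht) ?_
  filter_upwards [ae_restrict_mem measurableSet_Ioi] with x hx
  have h2 := (crossAmplitude_le hb hb' hx).trans (refProfile_le_one hx)
  have h3 := (crossAmplitude_pos hb hb' hx).le
  rw [norm_mul, norm_mul, Real.norm_of_nonneg h3, Real.norm_of_nonneg (Real.exp_pos _).le,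
    Real.norm_eq_abs, neg_mul]
  have h5 := abs_cos_le_one (c * x)
  calc _ ≤ 1 * (Real.exp (-(t * x)) * 1) := by gcongr
    _ = _ := by ring

theorem crossFactor_eq (b l : ℝ) :
    crossFactor b l = (Real.sinh l ^ 2 + Real.sin (2 * π * b) ^ 2) / Real.sinh l ^ 2 := by
  rw [crossFactor, crossFactor_ofReal, Complex.ofReal_re]

theorem crossFactor_pos (b : ℝ) {l : ℝ} (hl : l ≠ 0) : 0 < crossFactor b l := by
  have : Real.sinh l ≠ 0 := by rwa [Ne, Real.sinh_eq_zero]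
  rw [crossFactor_eq]
  positivity

/-- The Fourier representation of `ln c`. -/
theorem log_crossFactor {b l : ℝ} (hb : 0 < b) (hb' : b < 1 / 2) (hl : l ≠ 0) :
    Real.log (crossFactor b l) = 2 * abelTransform 1 (crossAmplitude b) 0 (l / π) := by
  have hc : l / π ≠ 0 := div_ne_zero hl Real.pi_ne_zero
  have h1 := tendsto_prod_eulerFactor hb hc
  rw [mul_div_cancel₀ l Real.pi_ne_zero, show π * (2 * b) = 2 * π * b by ring, add_comm,
    ← crossFactor_eq] at h1
  have h2 := h1.log (crossFactor_pos b hl).ne'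
  have h3 : Tendsto (fun M : ℕ => abelTransform 1 (crossAmplitude b) M (l / π)) atTop (𝓝 0) := by
    refine squeeze_zero_norm' ?_ tendsto_one_div_atTop_nhds_zero_nat
    filter_upwards [eventually_gt_atTop 0] with M hM
    exact abs_abelTransform_crossAmplitude_le hb hb' (by exact_mod_cast hM) _
  have h4 := h2.add (h3.const_mul 2)
  rw [mul_zero, add_zero] at h4
  refine tendsto_nhds_unique h4 (tendsto_const_nhds.congr' ?_)
  filter_upwards [eventually_gt_atTop 0] with M hM
  exact two_mul_abelTransform_crossAmplitude_eq hb hb' hc hM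

/-! ### Fourier representation of `𝔴` and `𝔴⁽⁺⁾`. -/

theorem potentialAmplitude_neg (b x : ℝ) :
    potentialAmplitude b (-x) = potentialAmplitude b x := by
  unfold potentialAmplitude
  rw [show -x * b = -(x * b) by ring, show -x * (1 / 2 - b) = -(x * (1 / 2 - b)) by ring,
    show -x / 2 = -(x / 2) by ring, Real.sinh_neg, Real.sinh_neg, Real.sinh_neg, Real.sinh_neg,
    Real.cosh_neg, neg_sq, ← neg_div_neg_eq]
  congr 1 <;> ring

/-- The right side is one eighth of `crossAmplitude` times `1 + tanh² (x / 2) = cosh x / cosh² (x /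
2)`. In the variables `p = exp (x b)` and `q = exp (x (1/2 - b))` all this is a rational identity.
-/
theorem potentialAmplitude_eq {b x : ℝ} (hx : 0 < x) :
    potentialAmplitude b x = 1 / 4 * plusAmplitude b x + 1 / 8 * crossAmplitude b x := by
  set p := Real.exp (x * b) with hp
  set q := Real.exp (x * (1 / 2 - b)) with hq
  have hp0 : 0 < p := Real.exp_pos _
  have hq0 : 0 < q := Real.exp_pos _
  have e1 : Real.exp (x / 2) = p * q := by rw [hp, hq, ← Real.exp_add]; ring_nf
  have e2 : Real.exp x = p ^ 2 * q ^ 2 := by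
    rw [← mul_pow, ← e1, ← Real.exp_nat_mul]; push_cast; ring_nf
  have e3 : Real.exp (-(2 * b * x)) = (p ^ 2)⁻¹ := by
    rw [hp, ← Real.exp_nat_mul, ← Real.exp_neg]; push_cast; ring_nf
  have e4 : Real.exp (-((1 - 2 * b) * x)) = (q ^ 2)⁻¹ := by
    rw [hq, ← Real.exp_nat_mul, ← Real.exp_neg]; push_cast; ring_nf
  have h1 : 1 < p ^ 2 * q ^ 2 := by rw [← e2]; exact Real.one_lt_exp_iff.2 hx
  have h2 : p ^ 2 * q ^ 2 - 1 ≠ 0 := by linarith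
  have h3 : p ^ 2 * q ^ 2 + 1 ≠ 0 := by positivity
  have f1 : (p ^ 2 * q ^ 2 - (p ^ 2 * q ^ 2)⁻¹) =
      (p ^ 2 * q ^ 2 - 1) * (p ^ 2 * q ^ 2 + 1) / (p ^ 2 * q ^ 2) := by field_simp; ring
  have f2 : 1 - (p ^ 2 * q ^ 2)⁻¹ = (p ^ 2 * q ^ 2 - 1) / (p ^ 2 * q ^ 2) := by field_simp
  have f3 : 1 + (p ^ 2 * q ^ 2)⁻¹ = (p ^ 2 * q ^ 2 + 1) / (p ^ 2 * q ^ 2) := by field_simp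
  simp only [potentialAmplitude, plusAmplitude, crossAmplitude, Real.sinh_eq, Real.cosh_eq,
    Real.exp_neg x, Real.exp_neg (x * b), Real.exp_neg (x / 2), Real.exp_neg (x * (1 / 2 - b)),
    ← hp, ← hq, e1, e2, e3, e4]
  rw [f1, f2, f3]
  field_simp
  ring

/-- The two-body potential in terms of the two amplitudes. -/
theorem pairPotential_eq {b l : ℝ} (hb : 0 < b) (hb' : b < 1 / 2) (hl : l ≠ 0) :
    pairPotential b l = -2 * abelTransform (1 / 2) (plusAmplitude b) 0 (l / π) -
      abelTransform 1 (crossAmplitude b) 0 (l / π) := by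
  have hc : l / π ≠ 0 := div_ne_zero hl Real.pi_ne_zero
  have hg := isProfile_plusAmplitude hb hb'
  have hh := isProfile_crossAmplitude hb hb'
  refine Tendsto.limUnder_eq ?_
  refine (((hg.tendsto_integral hc).const_mul (-2)).sub (hh.tendsto_integral hc)).congr' ?_
  filter_upwards [eventually_ge_atTop 0] with A hA
  have hG := hg.intervalIntegrable (l / π) hA
  have hH := hh.intervalIntegrable (l / π) hA
  have hcongr : Set.EqOn (fun x => 1 / 4 * (plusAmplitude b x * Real.cos (l / π * x)) +
      1 / 8 * (crossAmplitude b x * Real.cos (l / π * x)))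
      (fun x => potentialAmplitude b x * Real.cos (l * x / π)) (Set.uIoc 0 A) := by
    intro x hx
    rw [Set.uIoc_of_le hA] at hx
    simp only
    rw [potentialAmplitude_eq hx.1, div_mul_eq_mul_div]
    ring_nf
  have h1 : IntervalIntegrable (fun x => potentialAmplitude b x * Real.cos (l * x / π))
      volume 0 A := ((hG.const_mul (1 / 4)).add (hH.const_mul (1 / 8))).congr hcongr
  have heven : ∀ x, potentialAmplitude b (-x) * Real.cos (l * -x / π) =
      potentialAmplitude b x * Real.cos (l * x / π) := by
    intro x
    rw [potentialAmplitude_neg, mul_neg, neg_div, Real.cos_neg]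
  have h2 : ∫ x in (-A)..0, potentialAmplitude b x * Real.cos (l * x / π) =
      ∫ x in (0 : ℝ)..A, potentialAmplitude b x * Real.cos (l * x / π) := by
    rw [← intervalIntegral.integral_congr (fun x _ => heven x),
      intervalIntegral.integral_comp_neg
        (fun x => potentialAmplitude b x * Real.cos (l * x / π))]
    simp
  have h3 : IntervalIntegrable (fun x => potentialAmplitude b x * Real.cos (l * x / π))
      volume (-A) 0 := by
    have := (IntervalIntegrable.comp_sub_left h1 0)
    simp only [zero_sub, heven, neg_zero] at this
    simpa using this.symm
  rw [← intervalIntegral.integral_add_adjacent_intervals h3 h1, h2,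
    ← intervalIntegral.integral_congr_ae (ae_of_all _ fun x hx => hcongr hx),
    intervalIntegral.integral_add (hG.const_mul _) (hH.const_mul _),
    intervalIntegral.integral_const_mul, intervalIntegral.integral_const_mul]
  ring

/-- Half of `ln c` cancels the `crossAmplitude` part of `𝔴` exactly. -/
theorem potentialPlus_eq {b u : ℝ} (hb : 0 < b) (hb' : b < 1 / 2) (hu : u ≠ 0) :
    potentialPlus b u =
      ((-2 * abelTransform (1 / 2) (plusAmplitude b) 0 (u / π) : ℝ) : EReal) := by
  rw [potentialPlus, if_neg hu, correctionPotential, log_crossFactor hb hb' hu,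
    pairPotential_eq hb hb' hu]
  congr 1
  ring

/-! ### Monotone approximation of the energy kernel. -/

/-- The loss in the comparison of the Abel regularised transform with the transform itself. -/
def abelLoss (κ : ℝ) (f : ℝ → ℝ) : ℝ :=
  2 * κ + ∫ x in Set.Ioi (0 : ℝ), |x * profileRem κ f x|

theorem abelLoss_nonneg {κ : ℝ} (hκ : 0 ≤ κ) (f : ℝ → ℝ) : 0 ≤ abelLoss κ f :=
  add_nonneg (by positivity) (integral_nonneg fun _ => abs_nonneg _)

/-- An upper bound of `𝔴⁽⁺⁾`. -/
def plusBound (b : ℝ) : ℝ := 2 * abelLoss (1 / 2) (plusAmplitude b) + 1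

/-- Bounded nonnegative kernels increasing to `plusBound b - 𝔴⁽⁺⁾`. -/
def regKernel (b : ℝ) (n : ℕ) (u : ℝ) : ℝ :=
  2 * (abelTransform (1 / 2) (plusAmplitude b) (1 / (n + 1)) (u / π) -
    abelLoss (1 / 2) (plusAmplitude b) * (1 / (n + 1))) + plusBound b

/-- The kernel `plusBound b - 𝔴⁽⁺⁾`, with values in `[0, +∞]`. -/
def energyKernel (b u : ℝ) : ℝ≥0∞ := ⨆ n, ENNReal.ofReal (regKernel b n u)

/-- The quadratic part of the energy, in Fourier variables. -/
def fourierEnergy (b τ : ℝ) (σ : Measure ℝ) : ℝ≥0∞ :=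
  ∫⁻ x in Set.Ioi (0 : ℝ), ENNReal.ofReal (2 * plusAmplitude b x * ‖charFun σ (τ * x)‖ ^ 2)

theorem abelLoss_plusAmplitude_nonneg (b : ℝ) : 0 ≤ abelLoss (1 / 2) (plusAmplitude b) :=
  abelLoss_nonneg (by norm_num) _

theorem plusBound_pos (b : ℝ) : 0 < plusBound b := by
  have := abelLoss_plusAmplitude_nonneg b
  unfold plusBound
  linarith

theorem tendsto_one_div_nhdsGT :
    Tendsto (fun n : ℕ => (1 : ℝ) / (n + 1)) atTop (𝓝[>] 0) :=
  tendsto_nhdsWithin_iff.2 ⟨tendsto_one_div_add_atTop_nhds_zero_nat,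
    Eventually.of_forall fun n => by simp only [Set.mem_Ioi]; positivity⟩

section

variable {b : ℝ} (hb : 0 < b) (hb' : b < 1 / 2)

include hb hb'

theorem abs_abelTransform_plusAmplitude_le {t : ℝ} (ht : 0 < t) (c : ℝ) :
    |abelTransform (1 / 2) (plusAmplitude b) t c| ≤ 1 / 2 * (1 / t) := by
  rw [(isProfile_plusAmplitude hb hb').abelTransform_eq ht c]
  have h1 : ∫ x in Set.Ioi (0 : ℝ), 1 / 2 * Real.exp (-t * x) = 1 / 2 * (1 / t) := by
    rw [integral_const_mul, integral_exp_mul_Ioi (by linarith)]; simp [neg_div_neg_eq]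
  rw [← h1, ← Real.norm_eq_abs]
  refine norm_integral_le_of_norm_le (Integrable.const_mul (exp_neg_integrableOn_Ioi 0 ht) _) ?_
  filter_upwards [ae_restrict_mem measurableSet_Ioi] with x hx
  have h2 := plusAmplitude_le hb hb' hx
  have h6 := refProfile_le_one hx
  have h3 := (plusAmplitude_pos hb hb' hx).le
  rw [norm_mul, norm_mul, Real.norm_of_nonneg h3, Real.norm_of_nonneg (Real.exp_pos _).le,
    Real.norm_eq_abs, neg_mul]
  have h5 := abs_cos_le_one (c * x)
  calc _ ≤ 1 / 2 * (Real.exp (-(t * x)) * 1) := by gcongr; linarith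
    _ = _ := by ring

/-- Subtracting `abelLoss` times `t` turns the near-monotonicity of the Abel transform into genuine
monotonicity as `t` decreases. -/
theorem regKernel_mono (u : ℝ) : Monotone fun n => regKernel b n u := by
  intro m n hmn
  have h1 : (0 : ℝ) < 1 / (n + 1) := by positivity
  have h2 : (1 : ℝ) / (n + 1) ≤ 1 / (m + 1) := by
    have : (m : ℝ) ≤ n := by exact_mod_cast hmn
    gcongr
  have h3 : (1 : ℝ) / (m + 1) ≤ 1 := by
    rw [div_le_one (by positivity)]
    have : (0 : ℝ) ≤ m := m.cast_nonneg
    linarith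
  have := (isProfile_plusAmplitude hb hb').le_abelTransform_zero (c := u / π) (by norm_num) h1.le
    h2 h3 (by positivity)
  rw [← abelLoss] at this
  simp only [regKernel]
  linarith

theorem regKernel_nonneg (n : ℕ) (u : ℝ) : 0 ≤ regKernel b n u := by
  -- By monotonicity `n = 0`, that is `t = 1`, suffices. There the transform is at least `-1/2`, and
  -- `plusBound` is chosen to compensate this and the loss.
  refine le_trans ?_ (regKernel_mono hb hb' u (Nat.zero_le n))
  have := abs_abelTransform_plusAmplitude_le hb hb' one_pos (u / π)
  rw [abs_le] at this
  simp only [regKernel, plusBound, Nat.cast_zero, zero_add, div_one]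
  linarith [this.1]

theorem continuous_regKernel (n : ℕ) : Continuous (regKernel b n) := by
  have h := (isProfile_plusAmplitude hb hb').continuous_abelTransform
    (t := 1 / ((n : ℝ) + 1)) (by positivity)
  unfold regKernel
  exact (((h.comp (by fun_prop : Continuous fun u : ℝ => u / π)).sub
    continuous_const).const_mul 2).add continuous_const

theorem measurable_energyKernel : Measurable (energyKernel b) :=
  Measurable.iSup fun n => (continuous_regKernel hb hb' n).measurable.ennreal_ofReal

theorem regKernel_le (n : ℕ) (u : ℝ) : regKernel b n u ≤ (n + 1) + plusBound b := by
  have h1 : (0 : ℝ) < 1 / (n + 1) := by positivity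
  have := abs_abelTransform_plusAmplitude_le hb hb' h1 (u / π)
  rw [abs_le, one_div_one_div] at this
  have h3 := mul_nonneg (abelLoss_plusAmplitude_nonneg b) h1.le
  simp only [regKernel]
  linarith [this.2]

theorem tendsto_regKernel {u : ℝ} (hu : u ≠ 0) :
    Tendsto (fun n => regKernel b n u) atTop
      (𝓝 (2 * abelTransform (1 / 2) (plusAmplitude b) 0 (u / π) + plusBound b)) := by
  have h0 := tendsto_one_div_nhdsGT
  have h1 := ((isProfile_plusAmplitude hb hb').tendsto_abelTransform
    (div_ne_zero hu Real.pi_ne_zero)).comp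
      (h0.mono_right (nhdsWithin_mono 0 Set.Ioi_subset_Ici_self))
  have h2 := (((h1.sub ((h0.mono_right nhdsWithin_le_nhds).const_mul
    (abelLoss (1 / 2) (plusAmplitude b)))).const_mul 2).add_const (plusBound b))
  simpa [regKernel] using h2

theorem energyKernel_eq {u : ℝ} (hu : u ≠ 0) :
    energyKernel b u = ENNReal.ofReal
      (2 * abelTransform (1 / 2) (plusAmplitude b) 0 (u / π) + plusBound b) := by
  refine tendsto_nhds_unique (tendsto_atTop_iSup fun m n hmn => ?_)
    (ENNReal.tendsto_ofReal (tendsto_regKernel hb hb' hu))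
  exact ENNReal.ofReal_le_ofReal (regKernel_mono hb hb' u hmn)

/-- The value on the diagonal matters: the product of a measure having atoms charges it, and its
energy must be infinite. -/
theorem energyKernel_zero : energyKernel b 0 = ⊤ := by
  have h0 := tendsto_one_div_nhdsGT
  have h1 := ((isProfile_plusAmplitude hb hb').tendsto_abelTransform_atTop
    (by norm_num)).comp h0
  have h2 : Tendsto (fun n => regKernel b n 0) atTop atTop := by
    have h3 := ((h0.mono_right nhdsWithin_le_nhds).const_mul
      (abelLoss (1 / 2) (plusAmplitude b))).neg
    have h4 := tendsto_atTop_add_const_right _ (plusBound b)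
      ((h1.atTop_add h3).const_mul_atTop (zero_lt_two (α := ℝ)))
    refine h4.congr fun n => ?_
    simp [regKernel, sub_eq_add_neg]
  refine tendsto_nhds_unique (tendsto_atTop_iSup fun m n hmn => ?_)
    (ENNReal.tendsto_ofReal_atTop.comp h2)
  exact ENNReal.ofReal_le_ofReal (regKernel_mono hb hb' 0 hmn)

theorem potentialPlus_toENNReal (u : ℝ) :
    (potentialPlus b u).toENNReal = ENNReal.ofReal (plusBound b) - energyKernel b u ∧
      (-potentialPlus b u).toENNReal = energyKernel b u - ENNReal.ofReal (plusBound b) := by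
  rcases eq_or_ne u 0 with rfl | hu
  · rw [energyKernel_zero hb hb', potentialPlus, if_pos rfl]
    simp
  · have hnn : 0 ≤ 2 * abelTransform (1 / 2) (plusAmplitude b) 0 (u / π) + plusBound b :=
      ge_of_tendsto' (tendsto_regKernel hb hb' hu) fun n => regKernel_nonneg hb hb' n u
    rw [energyKernel_eq hb hb' hu, potentialPlus_eq hb hb' hu, ← EReal.coe_neg,
      EReal.toENNReal_of_ne_top (EReal.coe_ne_top _),
      EReal.toENNReal_of_ne_top (EReal.coe_ne_top _), EReal.toReal_coe, EReal.toReal_coe,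
      ← ENNReal.ofReal_sub _ hnn, ← ENNReal.ofReal_sub _ (plusBound_pos b).le]
    constructor <;> congr 1 <;> ring

end

/-! ### The energy in Fourier variables. -/

theorem integral_cos_sub (σ : Measure ℝ) [IsProbabilityMeasure σ] (t : ℝ) :
    ∫ z, Real.cos (t * (z.1 - z.2)) ∂(σ.prod σ) = ‖charFun σ t‖ ^ 2 := by
  have hc : Integrable (fun s => Real.cos (t * s)) σ :=
    Integrable.of_bound (by fun_prop) 1 (ae_of_all _ fun s => abs_cos_le_one _)
  have hs : Integrable (fun s => Real.sin (t * s)) σ :=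
    Integrable.of_bound (by fun_prop) 1 (ae_of_all _ fun s => abs_sin_le_one _)
  have h1 : charFun σ t = ((∫ s, Real.cos (t * s) ∂σ : ℝ) : ℂ) +
      ((∫ s, Real.sin (t * s) ∂σ : ℝ) : ℂ) * Complex.I := by
    rw [charFun_apply_real, ← integral_complex_ofReal, ← integral_complex_ofReal,
      ← integral_mul_const, ← integral_add hc.ofReal (hs.ofReal.mul_const _)]
    congr 1
    ext s
    rw [← Complex.ofReal_mul, Complex.exp_mul_I]
    simp
  rw [h1, ← Complex.normSq_eq_norm_sq, Complex.normSq_add_mul_I]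
  have h2 : ∀ z : ℝ × ℝ, Real.cos (t * (z.1 - z.2)) = Real.cos (t * z.1) * Real.cos (t * z.2) +
      Real.sin (t * z.1) * Real.sin (t * z.2) := by
    intro z; rw [mul_sub, Real.cos_sub]
  simp_rw [h2]
  rw [integral_add (hc.mul_prod hc) (hs.mul_prod hs),
    integral_prod_mul (fun s => Real.cos (t * s)) (fun s => Real.cos (t * s)),
    integral_prod_mul (fun s => Real.sin (t * s)) (fun s => Real.sin (t * s))]
  ring

theorem integral_abelTransform {κ : ℝ} {f : ℝ → ℝ} (hf : IsProfile κ f) {t : ℝ} (ht : 0 < t)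
    (τ : ℝ) (σ : Measure ℝ) [IsProbabilityMeasure σ] :
    ∫ z, abelTransform κ f t (τ * (z.1 - z.2)) ∂(σ.prod σ) =
      ∫ x in Set.Ioi (0 : ℝ), f x * Real.exp (-(t * x)) * ‖charFun σ (τ * x)‖ ^ 2 := by
  simp_rw [hf.abelTransform_eq ht]
  rw [integral_integral_swap]
  · refine setIntegral_congr_fun measurableSet_Ioi fun x _ => ?_
    rw [← integral_cos_sub, ← integral_const_mul]
    congr 1
    ext z
    ring_nf
  · have h0 : Integrable (fun x => f x * Real.exp (-(t * x))) (volume.restrict (Set.Ioi 0)) :=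
      (hf.integrableOn ht 0).congr (ae_of_all _ fun x => by simp)
    have h1 : Integrable (fun p : (ℝ × ℝ) × ℝ => (1 : ℝ) * (f p.2 * Real.exp (-(t * p.2))))
        ((σ.prod σ).prod (volume.restrict (Set.Ioi 0))) :=
      Integrable.mul_prod (f := fun _ : ℝ × ℝ => (1 : ℝ)) (integrable_const _) h0
    have h2 : Integrable (fun p : (ℝ × ℝ) × ℝ => ((1 : ℝ) * (f p.2 * Real.exp (-(t * p.2)))) *
        Real.cos (τ * (p.1.1 - p.1.2) * p.2))
        ((σ.prod σ).prod (volume.restrict (Set.Ioi 0))) :=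
      h1.mul_bdd (c := 1) (by fun_prop) (ae_of_all _ fun p => abs_cos_le_one _)
    refine h2.congr (ae_of_all _ fun p => ?_)
    simp only [Function.uncurry]
    ring

section

variable {b : ℝ} (hb : 0 < b) (hb' : b < 1 / 2)

include hb hb'

theorem lintegral_regKernel (n : ℕ) (L : ℝ) (σ : Measure ℝ) [IsProbabilityMeasure σ] :
    ∫⁻ z, ENNReal.ofReal (regKernel b n (L * (z.1 - z.2))) ∂(σ.prod σ) =
      ENNReal.ofReal (plusBound b - 2 * (abelLoss (1 / 2) (plusAmplitude b) * (1 / (n + 1)))) +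
      ∫⁻ x in Set.Ioi (0 : ℝ), ENNReal.ofReal
        (2 * plusAmplitude b x * Real.exp (-(1 / (n + 1) * x)) *
          ‖charFun σ (L / π * x)‖ ^ 2) := by
  have hf := isProfile_plusAmplitude hb hb'
  have ht : (0 : ℝ) < 1 / (n + 1) := by positivity
  have ht1 : (1 : ℝ) / (n + 1) ≤ 1 := by
    rw [div_le_one (by positivity)]
    have : (0 : ℝ) ≤ n := n.cast_nonneg
    linarith
  have hloss := abelLoss_plusAmplitude_nonneg b
  have hc : Continuous fun z : ℝ × ℝ => regKernel b n (L * (z.1 - z.2)) :=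
    (continuous_regKernel hb hb' n).comp (by fun_prop)
  have hi : Integrable (fun z : ℝ × ℝ => regKernel b n (L * (z.1 - z.2))) (σ.prod σ) := by
    refine Integrable.of_bound hc.aestronglyMeasurable ((n + 1) + plusBound b)
      (ae_of_all _ fun z => ?_)
    rw [Real.norm_of_nonneg (regKernel_nonneg hb hb' n _)]
    exact regKernel_le hb hb' n _
  have hca : Continuous fun z : ℝ × ℝ =>
      abelTransform (1 / 2) (plusAmplitude b) (1 / (n + 1)) (L / π * (z.1 - z.2)) :=
    (hf.continuous_abelTransform ht).comp (by fun_prop)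
  have hia : Integrable (fun z : ℝ × ℝ =>
      abelTransform (1 / 2) (plusAmplitude b) (1 / (n + 1)) (L / π * (z.1 - z.2)))
      (σ.prod σ) :=
    Integrable.of_bound hca.aestronglyMeasurable _
      (ae_of_all _ fun z => abs_abelTransform_plusAmplitude_le hb hb' ht _)
  have hnn : ∀ x ∈ Set.Ioi (0 : ℝ), 0 ≤ 2 * plusAmplitude b x * Real.exp (-(1 / (n + 1) * x)) *
      ‖charFun σ (L / π * x)‖ ^ 2 := by
    intro x hx
    have := plusAmplitude_pos hb hb' hx
    positivity
  have hix : IntegrableOn (fun x => 2 * plusAmplitude b x * Real.exp (-(1 / (n + 1) * x)) *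
      ‖charFun σ (L / π * x)‖ ^ 2) (Set.Ioi 0) := by
    have h0 : IntegrableOn (fun x => plusAmplitude b x * Real.exp (-(1 / (n + 1) * x)))
        (Set.Ioi 0) := by
      simpa using hf.integrableOn ht 0
    have h1 := Integrable.mul_bdd (c := 1) (Integrable.const_mul h0 2)
      (g := fun x => ‖charFun σ (L / π * x)‖ ^ 2) (by fun_prop) (ae_of_all _ fun x => by
        rw [Real.norm_of_nonneg (by positivity)]
        exact pow_le_one₀ (norm_nonneg _) (norm_charFun_le_one _))
    refine h1.congr (ae_of_all _ fun x => ?_)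
    simp only
    ring
  have hval : ∫ z, regKernel b n (L * (z.1 - z.2)) ∂(σ.prod σ) =
      (plusBound b - 2 * (abelLoss (1 / 2) (plusAmplitude b) * (1 / (n + 1)))) +
      ∫ x in Set.Ioi (0 : ℝ), 2 * plusAmplitude b x * Real.exp (-(1 / (n + 1) * x)) *
        ‖charFun σ (L / π * x)‖ ^ 2 := by
    have h1 : ∀ z : ℝ × ℝ, regKernel b n (L * (z.1 - z.2)) =
        2 * abelTransform (1 / 2) (plusAmplitude b) (1 / (n + 1)) (L / π * (z.1 - z.2)) +
        (plusBound b - 2 * (abelLoss (1 / 2) (plusAmplitude b) * (1 / (n + 1)))) := by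
      intro z
      rw [regKernel, mul_div_right_comm]
      ring
    simp_rw [h1]
    rw [integral_add (hia.const_mul 2) (integrable_const _), integral_const_mul,
      integral_abelTransform hf ht, ← integral_const_mul]
    simp only [integral_const, probReal_univ, one_smul]
    rw [add_comm]
    congr 1
    congr 1
    ext x
    ring
  rw [← ofReal_integral_eq_lintegral_ofReal hi (ae_of_all _ fun z => regKernel_nonneg hb hb' n _),
    hval, ENNReal.ofReal_add _ (setIntegral_nonneg measurableSet_Ioi hnn),
    ofReal_integral_eq_lintegral_ofReal hix]
  · filter_upwards [ae_restrict_mem measurableSet_Ioi] with x hx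
    exact hnn x hx
  · unfold plusBound
    nlinarith

/-- For each `t > 0` Fubini is legitimate. Then `t` decreases to `0` with monotone convergence on
both sides, so the identity also holds when both sides are infinite. -/
theorem lintegral_energyKernel (L : ℝ) (σ : Measure ℝ) [IsProbabilityMeasure σ] :
    ∫⁻ z, energyKernel b (L * (z.1 - z.2)) ∂(σ.prod σ) =
      ENNReal.ofReal (plusBound b) + fourierEnergy b (L / π) σ := by
  have hmeas : ∀ n, Measurable fun z : ℝ × ℝ =>
      ENNReal.ofReal (regKernel b n (L * (z.1 - z.2))) := fun n =>
    ((continuous_regKernel hb hb' n).comp (by fun_prop)).measurable.ennreal_ofReal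
  have hmono : Monotone fun n (z : ℝ × ℝ) =>
      ENNReal.ofReal (regKernel b n (L * (z.1 - z.2))) := fun m n hmn z =>
    ENNReal.ofReal_le_ofReal (regKernel_mono hb hb' _ hmn)
  have h0 := tendsto_one_div_nhdsGT
  unfold energyKernel
  rw [lintegral_iSup hmeas hmono]
  refine tendsto_nhds_unique (tendsto_atTop_iSup fun m n hmn => lintegral_mono (hmono hmn)) ?_
  simp_rw [lintegral_regKernel hb hb']
  refine Tendsto.add ?_ ?_
  · refine ENNReal.tendsto_ofReal ?_
    have := (((h0.mono_right nhdsWithin_le_nhds).const_mul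
      (abelLoss (1 / 2) (plusAmplitude b))).const_mul 2).const_sub (plusBound b)
    simpa using this
  · refine lintegral_tendsto_of_tendsto_of_monotone (fun n => by fun_prop) ?_ ?_
    · filter_upwards [ae_restrict_mem measurableSet_Ioi] with x hx m n hmn
      have hx : 0 < x := hx
      refine ENNReal.ofReal_le_ofReal ?_
      have := plusAmplitude_pos hb hb' hx
      have h2 : (1 : ℝ) / (n + 1) ≤ 1 / (m + 1) := by
        have : (m : ℝ) ≤ n := by exact_mod_cast hmn
        gcongr
      gcongr
    · refine ae_of_all _ fun x => ENNReal.tendsto_ofReal ?_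
      have h1 : Tendsto (fun n : ℕ => Real.exp (-((1 : ℝ) / (n + 1) * x))) atTop
          (𝓝 (Real.exp (-(0 * x)))) :=
        (Real.continuous_exp.tendsto _).comp
          ((h0.mono_right nhdsWithin_le_nhds).mul_const x).neg
      simpa using (h1.const_mul (2 * plusAmplitude b x)).mul_const (‖charFun σ (L / π * x)‖ ^ 2)

/-- The energy as an element of `[0, +∞]`. -/
def energyNN (b kappa : ℝ) (N : ℕ) (σ : Measure ℝ) : ℝ≥0∞ :=
  ENNReal.ofReal (1 / N) * ∫⁻ s, ENNReal.ofReal (confiningPotential kappa N s) ∂σ +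
    ENNReal.ofReal (1 / 2) * fourierEnergy b (Real.log N / π) σ

/-- With `K` the kernel and `C` its shift, the positive and negative parts of `𝔴⁽⁺⁾` are the
truncated differences `C - K` and `K - C`. Integrating `(C - K) + K = (K - C) + C` and cancelling
the finite `C` gives their difference, even if the energy is infinite. -/
theorem extIntegral_potentialPlus (L : ℝ) (σ : Measure ℝ) [IsProbabilityMeasure σ] :
    extIntegral (σ.prod σ) (fun z => potentialPlus b (L * (z.1 - z.2))) =
      -((fourierEnergy b (L / π) σ : ℝ≥0∞) : EReal) := by
  have hm : Measurable fun z : ℝ × ℝ => energyKernel b (L * (z.1 - z.2)) :=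
    (measurable_energyKernel hb hb').comp (by fun_prop)
  simp only [extIntegral, (potentialPlus_toENNReal hb hb' _).1,
    (potentialPlus_toENNReal hb hb' _).2]
  set C := ENNReal.ofReal (plusBound b)
  have hp : ∫⁻ z, C - energyKernel b (L * (z.1 - z.2)) ∂(σ.prod σ) ≠ ⊤ := by
    have : ∫⁻ z, C - energyKernel b (L * (z.1 - z.2)) ∂(σ.prod σ) ≤ ∫⁻ _, C ∂(σ.prod σ) :=
      lintegral_mono fun z => tsub_le_self
    refine ne_top_of_le_ne_top ?_ this
    simp [C]
  have h1 : (∫⁻ z, C - energyKernel b (L * (z.1 - z.2)) ∂(σ.prod σ)) +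
      ∫⁻ z, energyKernel b (L * (z.1 - z.2)) ∂(σ.prod σ) =
      (∫⁻ z, energyKernel b (L * (z.1 - z.2)) - C ∂(σ.prod σ)) + C := by
    rw [← lintegral_add_right _ hm]
    have : C = ∫⁻ _, C ∂(σ.prod σ) := by simp
    conv_rhs => rw [this]
    rw [← lintegral_add_right _ measurable_const]
    refine lintegral_congr fun z => ?_
    rw [tsub_add_eq_max, ← this, tsub_add_eq_max, max_comm]
  rw [lintegral_energyKernel hb hb', add_comm C, ← add_assoc] at h1
  have h2 := (ENNReal.add_left_inj (by simp [C])).1 h1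
  rw [← h2]
  generalize (∫⁻ z, C - energyKernel b (L * (z.1 - z.2)) ∂(σ.prod σ)) = P at hp
  generalize fourierEnergy b (L / π) σ = J
  lift P to NNReal using hp
  induction J with
  | top => simp
  | coe J =>
    rw [← ENNReal.coe_add]
    simp only [EReal.coe_nnreal_eq_coe_real]
    norm_cast
    push_cast
    ring

theorem energyPlus_eq {kappa : ℝ} (hk : 0 < kappa) (N : ℕ) (σ : ProbabilityMeasure ℝ) :
    energyPlus b kappa N σ = ((energyNN b kappa N σ : ℝ≥0∞) : EReal) := by
  have h1 : extIntegral (σ : Measure ℝ)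
      (fun s => ((confiningPotential kappa N s : ℝ) : EReal)) =
      ((∫⁻ s, ENNReal.ofReal (confiningPotential kappa N s) ∂(σ : Measure ℝ) : ℝ≥0∞) : EReal) := by
    have h2 : ∀ s, 0 ≤ confiningPotential kappa N s := fun s =>
      mul_nonneg hk.le (Real.cosh_pos _).le
    have h3 : ∀ s, (((confiningPotential kappa N s : ℝ) : EReal)).toENNReal =
        ENNReal.ofReal (confiningPotential kappa N s) := fun s => by
      rw [EReal.toENNReal_of_ne_top (EReal.coe_ne_top _), EReal.toReal_coe]
    have h4 : ∀ s, (-((confiningPotential kappa N s : ℝ) : EReal)).toENNReal = 0 := fun s => by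
      rw [EReal.toENNReal_eq_zero_iff, ← EReal.coe_neg]
      exact_mod_cast neg_nonpos.2 (h2 s)
    simp only [extIntegral, h3, h4, lintegral_zero]
    simp
  have e : ∀ r : ℝ, 0 ≤ r → (r : EReal) = ((ENNReal.ofReal r : ℝ≥0∞) : EReal) := fun r hr => by
    rw [EReal.coe_ennreal_ofReal, max_eq_left hr]
  rw [energyPlus, h1, extIntegral_potentialPlus hb hb', energyNN, mul_neg, sub_eq_add_neg, neg_neg,
    e (1 / N) (by positivity), e (1 / 2) (by norm_num), EReal.coe_ennreal_add,
    EReal.coe_ennreal_mul, EReal.coe_ennreal_mul]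

end

/-! ### Mixtures, lower semicontinuity and existence of a minimiser. -/

/-- The average of finitely many measures. -/
def mixture {ι : Type*} [Fintype ι] (μ : ι → Measure ℝ) : Measure ℝ :=
  (Fintype.card ι : ℝ≥0∞)⁻¹ • ∑ i, μ i

section mixture

variable {ι : Type*} [Fintype ι] (μ : ι → Measure ℝ)

theorem isProbabilityMeasure_mixture (hn : Fintype.card ι ≠ 0) [∀ i, IsProbabilityMeasure (μ i)] :
    IsProbabilityMeasure (mixture μ) := by
  refine ⟨?_⟩
  simp only [mixture, Measure.smul_apply, Measure.coe_finsetSum, Finset.sum_apply, measure_univ,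
    Finset.sum_const, Finset.card_univ, nsmul_eq_mul, mul_one, smul_eq_mul]
  exact ENNReal.inv_mul_cancel (by exact_mod_cast hn) (ENNReal.natCast_ne_top _)

theorem lintegral_mixture (f : ℝ → ℝ≥0∞) :
    ∫⁻ s, f s ∂(mixture μ) = (Fintype.card ι : ℝ≥0∞)⁻¹ * ∑ i, ∫⁻ s, f s ∂(μ i) := by
  rw [mixture, lintegral_smul_measure, lintegral_finsetSum_measure, smul_eq_mul]

theorem charFun_mixture [∀ i, IsProbabilityMeasure (μ i)] (t : ℝ) :
    charFun (mixture μ) t = (Fintype.card ι : ℂ)⁻¹ * ∑ i, charFun (μ i) t := by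
  simp only [charFun_apply_real, mixture]
  rw [integral_smul_measure, integral_finsetSum_measure]
  · simp [ENNReal.toReal_inv]
  · intro i _
    refine Integrable.of_bound (by fun_prop) 1 (ae_of_all _ fun s => ?_)
    rw [← Complex.ofReal_mul, Complex.norm_exp_ofReal_mul_I]

end mixture

/-- Weak convergence makes characteristic functions converge pointwise, and the integrand is
nonnegative, so this is Fatou's lemma. -/
theorem fourierEnergy_le_liminf {b : ℝ} (τ : ℝ) {μ : ℕ → ProbabilityMeasure ℝ}
    {μ₀ : ProbabilityMeasure ℝ} (h : Tendsto μ atTop (𝓝 μ₀)) :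
    fourierEnergy b τ μ₀ ≤ liminf (fun n => fourierEnergy b τ (μ n)) atTop := by
  unfold fourierEnergy
  refine le_trans (le_of_eq ?_) (lintegral_liminf_le fun n => by fun_prop)
  refine lintegral_congr fun x => ?_
  refine (Tendsto.liminf_eq ?_).symm
  refine ENNReal.tendsto_ofReal (Tendsto.const_mul _ ?_)
  exact (ProbabilityMeasure.tendsto_iff_tendsto_charFun.1 h (τ * x)).norm.pow 2

theorem continuous_confiningPotential (kappa : ℝ) (N : ℕ) :
    Continuous (confiningPotential kappa N) := by
  unfold confiningPotential; fun_prop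

theorem add_liminf_le_liminf_add (u v : ℕ → ℝ≥0∞) :
    liminf u atTop + liminf v atTop ≤ liminf (fun n => u n + v n) atTop := by
  have hmono : ∀ w : ℕ → ℝ≥0∞, Monotone fun n => ⨅ i, ⨅ (_ : i ≥ n), w i := fun w m n hmn =>
    le_iInf₂ fun i hi => iInf₂_le i (hmn.trans hi)
  simp only [liminf_eq_iSup_iInf_of_nat]
  rw [ENNReal.iSup_add_iSup_of_monotone (hmono u) (hmono v)]
  exact iSup_mono fun n => le_iInf₂ fun i hi => add_le_add (iInf₂_le i hi) (iInf₂_le i hi)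

theorem energyNN_le_liminf {b kappa : ℝ} (hk : 0 < kappa) (N : ℕ) {μ : ℕ → ProbabilityMeasure ℝ}
    {μ₀ : ProbabilityMeasure ℝ} (h : Tendsto μ atTop (𝓝 μ₀)) :
    energyNN b kappa N μ₀ ≤ liminf (fun n => energyNN b kappa N (μ n)) atTop := by
  have h1 : ∫⁻ s, ENNReal.ofReal (confiningPotential kappa N s) ∂(μ₀ : Measure ℝ) ≤
      liminf (fun n => ∫⁻ s, ENNReal.ofReal (confiningPotential kappa N s) ∂(μ n : Measure ℝ))
        atTop :=
    lintegral_le_liminf_lintegral_of_forall_isOpen_measure_le_liminf_measure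
      (continuous_confiningPotential kappa N) (fun s => mul_nonneg hk.le (Real.cosh_pos _).le)
      fun G hG => ProbabilityMeasure.le_liminf_measure_open_of_tendsto h hG
  have hc : ∀ (r : ℝ) (u : ℕ → ℝ≥0∞), ENNReal.ofReal r * liminf u atTop =
      liminf (fun n => ENNReal.ofReal r * u n) atTop := fun r u =>
    (ENNReal.liminf_const_mul_of_ne_top ENNReal.ofReal_ne_top).symm
  unfold energyNN
  calc _ ≤ ENNReal.ofReal (1 / N) * _ + ENNReal.ofReal (1 / 2) * _ :=
        add_le_add (mul_le_mul_right h1 _)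
          (mul_le_mul_right (fourierEnergy_le_liminf (Real.log N / π) h) _)
    _ ≤ _ := by rw [hc, hc]; exact add_liminf_le_liminf_add _ _

/-- Both parts of the energy being nonnegative, the bound controls the confining integral; Markov's
inequality with `|u| ≤ cosh u` then makes the tails uniformly small. -/
theorem isTightMeasureSet_energyNN_le {b kappa : ℝ} (hk : 0 < kappa) {N : ℕ} (hN : 2 ≤ N)
    {C : ℝ≥0∞} (hC : C ≠ ⊤) :
    IsTightMeasureSet {x | ∃ μ ∈ {σ : ProbabilityMeasure ℝ | energyNN b kappa N σ ≤ C},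
      (μ : Measure ℝ) = x} := by
  have hN0 : (0 : ℝ) < N := by exact_mod_cast (by omega : 0 < N)
  have hL : 0 < Real.log N := Real.log_pos (by exact_mod_cast (by omega : 1 < N))
  apply isTightMeasureSet_of_tendsto_measure_norm_gt
  set D : ℝ≥0∞ := ENNReal.ofReal N * C
  have hD : D ≠ ⊤ := ENNReal.mul_ne_top ENNReal.ofReal_ne_top hC
  have hbound : ∀ r : ℝ, 0 < r → (⨆ μ ∈ {x | ∃ μ ∈ {σ : ProbabilityMeasure ℝ |
      energyNN b kappa N σ ≤ C}, (μ : Measure ℝ) = x}, μ {x | r < ‖x‖}) ≤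
      D / ENNReal.ofReal (kappa * (Real.log N * r)) := by
    intro r hr
    refine iSup₂_le ?_
    rintro _ ⟨σ, hσ, rfl⟩
    have hpos : 0 < kappa * (Real.log N * r) := by positivity
    have h1 : ∫⁻ s, ENNReal.ofReal (confiningPotential kappa N s) ∂(σ : Measure ℝ) ≤ D := by
      have h2 : ENNReal.ofReal (1 / N) *
          ∫⁻ s, ENNReal.ofReal (confiningPotential kappa N s) ∂(σ : Measure ℝ) ≤ C :=
        le_self_add.trans hσ
      calc _ = ENNReal.ofReal N * (ENNReal.ofReal (1 / N) *
          ∫⁻ s, ENNReal.ofReal (confiningPotential kappa N s) ∂(σ : Measure ℝ)) := by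
            rw [← mul_assoc, ← ENNReal.ofReal_mul hN0.le, mul_one_div_cancel hN0.ne',
              ENNReal.ofReal_one, one_mul]
        _ ≤ _ := mul_le_mul_right h2 _
    refine le_trans (measure_mono fun s hs => ?_) ((meas_ge_le_lintegral_div
      (μ := (σ : Measure ℝ)) (f := fun s => ENNReal.ofReal (confiningPotential kappa N s))
      (continuous_confiningPotential kappa N).measurable.ennreal_ofReal.aemeasurable
      (ε := ENNReal.ofReal (kappa * (Real.log N * r))) (by simpa using hpos)
      ENNReal.ofReal_ne_top).trans (ENNReal.div_le_div_right h1 _))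
    refine ENNReal.ofReal_le_ofReal ?_
    have hs : r < |s| := hs
    unfold confiningPotential
    have h3 : |Real.log N * s| ≤ Real.cosh (Real.log N * s) := by
      rw [← Real.cosh_abs]
      have h4 := Real.self_le_sinh_iff.2 (abs_nonneg (Real.log N * s))
      exact h4.trans (Real.sinh_lt_cosh _).le
    rw [abs_mul, abs_of_pos hL] at h3
    have h5 : Real.log N * r ≤ Real.log N * |s| := by gcongr
    exact mul_le_mul_of_nonneg_left (h5.trans h3) hk.le
  refine tendsto_of_tendsto_of_tendsto_of_le_of_le' tendsto_const_nhds ?_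
    (Eventually.of_forall fun _ => zero_le) ((eventually_gt_atTop 0).mono hbound)
  rw [← ENNReal.div_top (a := D)]
  refine ENNReal.Tendsto.const_div ?_ (Or.inr hD)
  exact ENNReal.tendsto_ofReal_atTop.comp
    ((tendsto_id.const_mul_atTop hL).const_mul_atTop hk)

theorem exists_energyNN_minimizer {b kappa : ℝ} (hk : 0 < kappa) {N : ℕ} (hN : 2 ≤ N)
    {σ₁ : ProbabilityMeasure ℝ} (h₁ : energyNN b kappa N σ₁ ≠ ⊤) :
    ∃ σ₀ : ProbabilityMeasure ℝ, ∀ σ : ProbabilityMeasure ℝ,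
      energyNN b kappa N σ₀ ≤ energyNN b kappa N σ := by
  set E : ProbabilityMeasure ℝ → ℝ≥0∞ := fun σ => energyNN b kappa N σ
  have hm : sInf (Set.range E) ≠ ⊤ := ne_top_of_le_ne_top h₁ (sInf_le ⟨σ₁, rfl⟩)
  obtain ⟨u, -, hu, huE⟩ := exists_seq_tendsto_sInf (S := Set.range E) ⟨_, σ₁, rfl⟩
    (OrderBot.bddBelow _)
  choose μ hμ using huE
  have hev : ∀ᶠ n in atTop, u n ≤ sInf (Set.range E) + 1 :=
    hu.eventually (Iic_mem_nhds (ENNReal.lt_add_right hm one_ne_zero))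
  obtain ⟨n₀, hn₀⟩ := eventually_atTop.1 hev
  have hcomp := isCompact_closure_of_isTightMeasureSet (isTightMeasureSet_energyNN_le (b := b) hk hN
    (C := sInf (Set.range E) + 1) (ENNReal.add_ne_top.2 ⟨hm, ENNReal.one_ne_top⟩))
  -- The minimising sequence is shifted by `n₀` so that every term lies in the relatively compact
  -- sublevel set.
  obtain ⟨σ₀, -, φ, hφ, hlim⟩ := hcomp.tendsto_subseq (x := fun n => μ (n + n₀)) fun n =>
    subset_closure (show E (μ (n + n₀)) ≤ _ by rw [hμ]; exact hn₀ _ (by omega))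
  refine ⟨σ₀, fun σ => ?_⟩
  have h2 : Tendsto (fun n => E (μ (φ n + n₀))) atTop (𝓝 (sInf (Set.range E))) := by
    simp only [hμ]
    exact hu.comp (tendsto_atTop_mono (fun n => Nat.le_add_right _ _) hφ.tendsto_atTop)
  calc _ ≤ liminf (fun n => E (μ (φ n + n₀))) atTop := energyNN_le_liminf hk N hlim
    _ = sInf (Set.range E) := h2.liminf_eq
    _ ≤ _ := sInf_le ⟨σ, rfl⟩

/-! ### Uniqueness of the minimiser by strict convexity. -/

section Uniqueness

variable {b : ℝ} (hb : 0 < b) (hb' : b < 1 / 2)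

include hb hb'

theorem fourierEnergy_mixture (τ : ℝ) (σ σ' : ProbabilityMeasure ℝ) :
    fourierEnergy b τ (mixture ![(σ : Measure ℝ), (σ' : Measure ℝ)]) +
      ENNReal.ofReal (1 / 4) * (∫⁻ x in Set.Ioi (0 : ℝ), ENNReal.ofReal (2 * plusAmplitude b x *
        ‖charFun (σ : Measure ℝ) (τ * x) - charFun (σ' : Measure ℝ) (τ * x)‖ ^ 2)) =
      ENNReal.ofReal (1 / 2) * (fourierEnergy b τ σ + fourierEnergy b τ σ') := by
  have hinst : ∀ i, IsProbabilityMeasure (![(σ : Measure ℝ), (σ' : Measure ℝ)] i) := by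
    intro i; fin_cases i <;> simp <;> infer_instance
  unfold fourierEnergy
  rw [← lintegral_add_left (by fun_prop), ← lintegral_const_mul _ (by fun_prop),
    ← lintegral_const_mul _ (by fun_prop), ← lintegral_add_right _ (by fun_prop)]
  refine setLIntegral_congr_fun measurableSet_Ioi fun x hx => ?_
  have hg := (plusAmplitude_pos hb hb' hx).le
  rw [← ENNReal.ofReal_mul (by norm_num), ← ENNReal.ofReal_add (by positivity) (by positivity),
    ← ENNReal.ofReal_add (by positivity) (by positivity), ← ENNReal.ofReal_mul (by norm_num)]
  congr 1
  rw [charFun_mixture]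
  simp only [Fin.sum_univ_two, Matrix.cons_val_zero, Matrix.cons_val_one, Fintype.card_fin]
  have h := parallelogram_law_with_norm ℝ (charFun (σ : Measure ℝ) (τ * x))
    (charFun (σ' : Measure ℝ) (τ * x))
  rw [norm_mul, mul_pow]
  norm_num
  nlinarith [h]

/-- Strict positivity of the amplitude forces equality almost everywhere on the half line.
Continuity makes it everywhere, conjugation extends it to negative arguments, and characteristic
functions determine the measure. -/
theorem eq_of_charFun_ae_eq {τ : ℝ} (hτ : 0 < τ) {σ σ' : ProbabilityMeasure ℝ}
    (h : ∫⁻ x in Set.Ioi (0 : ℝ), ENNReal.ofReal (2 * plusAmplitude b x *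
        ‖charFun (σ : Measure ℝ) (τ * x) - charFun (σ' : Measure ℝ) (τ * x)‖ ^ 2) = 0) :
    σ = σ' := by
  have hcont : ∀ σ : ProbabilityMeasure ℝ, Continuous (charFun (σ : Measure ℝ)) :=
    fun σ => continuous_charFun
  rw [lintegral_eq_zero_iff (by fun_prop)] at h
  have h1 : (fun x => charFun (σ : Measure ℝ) (τ * x)) =ᵐ[volume.restrict (Set.Ioi 0)]
      (fun x => charFun (σ' : Measure ℝ) (τ * x)) := by
    filter_upwards [h, ae_restrict_mem measurableSet_Ioi] with x hx hx0
    have hg := plusAmplitude_pos hb hb' hx0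
    simp only [Pi.zero_apply, ENNReal.ofReal_eq_zero] at hx
    by_contra hne
    have : 0 < ‖charFun (σ : Measure ℝ) (τ * x) - charFun (σ' : Measure ℝ) (τ * x)‖ :=
      norm_pos_iff.2 (sub_ne_zero.2 hne)
    have : 0 < 2 * plusAmplitude b x *
      ‖charFun (σ : Measure ℝ) (τ * x) - charFun (σ' : Measure ℝ) (τ * x)‖ ^ 2 := by positivity
    linarith
  have h2 := Measure.eqOn_open_of_ae_eq h1 isOpen_Ioi
    ((hcont σ).comp (by fun_prop)).continuousOn ((hcont σ').comp (by fun_prop)).continuousOn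
  have h3 : ∀ t, 0 < t → charFun (σ : Measure ℝ) t = charFun (σ' : Measure ℝ) t := by
    intro t ht
    have := h2 (show t / τ ∈ Set.Ioi 0 from div_pos ht hτ)
    simpa only [mul_div_cancel₀ t hτ.ne'] using this
  apply Subtype.ext
  refine Measure.ext_of_charFun (μ := (σ : Measure ℝ)) (ν := (σ' : Measure ℝ)) ?_
  ext t
  rcases lt_trichotomy t 0 with ht | rfl | ht
  · have := h3 (-t) (by linarith)
    rw [charFun_neg, charFun_neg] at this
    exact (starRingEnd ℂ).injective this
  · simp [charFun_zero]
  · exact h3 t ht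

theorem energyNN_minimizer_unique {kappa : ℝ} {N : ℕ} (hN : 2 ≤ N)
    {σ σ' : ProbabilityMeasure ℝ} (hfin : energyNN b kappa N σ ≠ ⊤)
    (h : ∀ ρ : ProbabilityMeasure ℝ, energyNN b kappa N σ ≤ energyNN b kappa N ρ)
    (h' : ∀ ρ : ProbabilityMeasure ℝ, energyNN b kappa N σ' ≤ energyNN b kappa N ρ) :
    σ' = σ := by
  have hL : 0 < Real.log N := Real.log_pos (by exact_mod_cast (by omega : 1 < N))
  have hinst : ∀ i, IsProbabilityMeasure (![(σ : Measure ℝ), (σ' : Measure ℝ)] i) := by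
    intro i; fin_cases i <;> simp <;> infer_instance
  let ρ : ProbabilityMeasure ℝ := ⟨mixture ![(σ : Measure ℝ), (σ' : Measure ℝ)],
    isProbabilityMeasure_mixture _ (by simp)⟩
  have heq : energyNN b kappa N σ' = energyNN b kappa N σ := le_antisymm (h' σ) (h σ')
  set D := ∫⁻ x in Set.Ioi (0 : ℝ), ENNReal.ofReal (2 * plusAmplitude b x *
    ‖charFun (σ : Measure ℝ) (Real.log N / π * x) -
      charFun (σ' : Measure ℝ) (Real.log N / π * x)‖ ^ 2) with hD
  have h2 : (2 : ℝ≥0∞)⁻¹ = ENNReal.ofReal (1 / 2) := by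
    rw [one_div, ENNReal.ofReal_inv_of_pos two_pos]; simp
  -- The confining part is affine and the quadratic part obeys the parallelogram law, so the
  -- midpoint beats the minimum by a multiple of the distance `D`, which must then vanish.
  have hsum : energyNN b kappa N ρ + ENNReal.ofReal (1 / 2) * (ENNReal.ofReal (1 / 4) * D) =
      energyNN b kappa N σ := by
    have h3 : energyNN b kappa N ρ + ENNReal.ofReal (1 / 2) * (ENNReal.ofReal (1 / 4) * D) =
        ENNReal.ofReal (1 / 2) * (energyNN b kappa N σ + energyNN b kappa N σ') := by
      have h4 := fourierEnergy_mixture hb hb' (Real.log N / π) σ σ'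
      rw [← hD] at h4
      simp only [energyNN, ρ, ProbabilityMeasure.coe_mk]
      rw [add_assoc, ← mul_add (ENNReal.ofReal (1 / 2)), h4, lintegral_mixture]
      rw [Fintype.card_fin, show (((2 : ℕ) : ℝ≥0∞))⁻¹ = ENNReal.ofReal (1 / 2) from h2]
      simp only [Fin.sum_univ_two, Matrix.cons_val_zero, Matrix.cons_val_one]
      ring
    rw [h3, heq, ← two_mul, ← mul_assoc, ← h2, ENNReal.inv_mul_cancel two_ne_zero
      ENNReal.ofNat_ne_top, one_mul]
  have hle := h ρ
  have hzero : ENNReal.ofReal (1 / 2) * (ENNReal.ofReal (1 / 4) * D) = 0 := by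
    have h5 : energyNN b kappa N σ + ENNReal.ofReal (1 / 2) * (ENNReal.ofReal (1 / 4) * D) ≤
        energyNN b kappa N σ + 0 := by
      rw [add_zero]
      exact (add_le_add_left hle _).trans hsum.le
    exact le_antisymm ((ENNReal.add_le_add_iff_left hfin).1 h5) zero_le
  have hD0 : D = 0 := by
    simpa using hzero
  exact (eq_of_charFun_ae_eq hb hb' (div_pos hL Real.pi_pos) hD0).symm

end Uniqueness

/-! ### Configurations and the Gaussian smearing of their empirical measure. -/

section Configurations

variable {ι : Type*} [Fintype ι]

/-- The squared modulus of `∑ εᵢ exp (i xᵢ y / π)`. -/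
def structureFactor (ε x : ι → ℝ) (y : ℝ) : ℝ :=
  (∑ i, ε i * Real.cos (x i / π * y)) ^ 2 + (∑ i, ε i * Real.sin (x i / π * y)) ^ 2

theorem structureFactor_nonneg (ε x : ι → ℝ) (y : ℝ) : 0 ≤ structureFactor ε x y := by
  unfold structureFactor; positivity

@[fun_prop]
theorem continuous_structureFactor (ε x : ι → ℝ) : Continuous (structureFactor ε x) := by
  unfold structureFactor; fun_prop

theorem sum_mul_cos_sub (ε x : ι → ℝ) (y : ℝ) :
    ∑ i, ∑ j, ε i * ε j * Real.cos ((x i - x j) / π * y) = structureFactor ε x y := by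
  simp only [structureFactor, sq, Finset.sum_mul_sum, ← Finset.sum_add_distrib]
  refine Finset.sum_congr rfl fun i _ => Finset.sum_congr rfl fun j _ => ?_
  rw [sub_div, sub_mul, Real.cos_sub]
  ring

theorem norm_sum_exp_sq (x : ι → ℝ) (y : ℝ) :
    ‖∑ i, Complex.exp ((y * (x i / π) : ℝ) * Complex.I)‖ ^ 2 =
      structureFactor (fun _ => 1) x y := by
  have : ∑ i, Complex.exp ((y * (x i / π) : ℝ) * Complex.I) =
      ((∑ i, Real.cos (x i / π * y) : ℝ) : ℂ) + ((∑ i, Real.sin (x i / π * y) : ℝ) : ℂ) *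
        Complex.I := by
    push_cast
    rw [Finset.sum_mul, ← Finset.sum_add_distrib]
    refine Finset.sum_congr rfl fun i _ => ?_
    rw [Complex.exp_mul_I, mul_comm (y : ℂ)]
  rw [this, ← Complex.normSq_eq_norm_sq, Complex.normSq_add_mul_I]
  simp [structureFactor]

theorem IsProfile.integrableOn_structureFactor {κ : ℝ} {f : ℝ → ℝ} (hf : IsProfile κ f) {t : ℝ}
    (ht : 0 < t) (ε x : ι → ℝ) :
    IntegrableOn (fun y => f y * (Real.exp (-(t * y)) * structureFactor ε x y)) (Set.Ioi 0) := by
  simp only [← sum_mul_cos_sub, Finset.mul_sum]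
  refine integrable_finsetSum _ fun i _ => integrable_finsetSum _ fun j _ => ?_
  refine (Integrable.const_mul (hf.integrableOn ht ((x i - x j) / π)) (ε i * ε j)).congr
    (ae_of_all _ fun y => ?_)
  simp only
  ring

theorem sum_mul_abelTransform {κ : ℝ} {f : ℝ → ℝ} (hf : IsProfile κ f) {t : ℝ} (ht : 0 < t)
    (ε x : ι → ℝ) :
    ∑ i, ∑ j, ε i * ε j * abelTransform κ f t ((x i - x j) / π) =
      ∫ y in Set.Ioi (0 : ℝ), f y * (Real.exp (-(t * y)) * structureFactor ε x y) := by
  have hi : ∀ i j, IntegrableOn (fun y => ε i * ε j * (f y * (Real.exp (-(t * y)) *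
      Real.cos ((x i - x j) / π * y)))) (Set.Ioi 0) := fun i j =>
    Integrable.const_mul (hf.integrableOn ht _) _
  simp_rw [hf.abelTransform_eq ht, ← integral_const_mul]
  simp_rw [← integral_finsetSum _ fun j _ => hi _ j]
  rw [← integral_finsetSum _ fun i _ => integrable_finsetSum _ fun j _ => hi i j]
  congr 1
  ext y
  rw [← sum_mul_cos_sub, Finset.mul_sum, Finset.mul_sum]
  refine Finset.sum_congr rfl fun i _ => ?_
  rw [Finset.mul_sum, Finset.mul_sum]
  exact Finset.sum_congr rfl fun j _ => by ring

theorem sum_mul_abelTransform_nonneg {κ : ℝ} {f : ℝ → ℝ} (hf : IsProfile κ f)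
    (hf0 : ∀ y, 0 < y → 0 ≤ f y) {t : ℝ} (ht : 0 < t) (ε x : ι → ℝ) :
    0 ≤ ∑ i, ∑ j, ε i * ε j * abelTransform κ f t ((x i - x j) / π) := by
  rw [sum_mul_abelTransform hf ht]
  refine setIntegral_nonneg measurableSet_Ioi fun y hy => ?_
  have := hf0 y hy
  have := structureFactor_nonneg ε x y
  positivity

/-- The empirical measure of the rescaled configuration, smeared by a Gaussian. -/
def smearedMeasure (N : ℕ) (x : ι → ℝ) : Measure ℝ :=
  mixture fun i => ProbabilityTheory.gaussianReal (x i / Real.log N)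
    (Real.toNNReal (1 / (N * Real.log N ^ 2)))

theorem isProbabilityMeasure_smearedMeasure (N : ℕ) (x : ι → ℝ) (hι : Fintype.card ι ≠ 0) :
    IsProbabilityMeasure (smearedMeasure N x) :=
  isProbabilityMeasure_mixture _ hι

/-- The regularised energy of a configuration. -/
def configEnergy (b kappa : ℝ) (x : ι → ℝ) : ℝ :=
  kappa * ∑ i, Real.cosh (x i) + ∑ i, ∑ j,
    abelTransform (1 / 2) (plusAmplitude b) (1 / Fintype.card ι) ((x i - x j) / π)

/-- In the unscaled variable the Gaussian has variance `1 / N`, so smearing multiplies `cosh` only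
by `exp (1 / (2 N))`. -/
theorem lintegral_confiningPotential_gaussianReal {kappa : ℝ} (hk : 0 < kappa) {N : ℕ}
    (hN : 2 ≤ N) (a : ℝ) :
    ∫⁻ s, ENNReal.ofReal (confiningPotential kappa N s) ∂(ProbabilityTheory.gaussianReal
      (a / Real.log N) (Real.toNNReal (1 / (N * Real.log N ^ 2)))) =
      ENNReal.ofReal (Real.exp (1 / (2 * N)) * (kappa * Real.cosh a)) := by
  have hN0 : (0 : ℝ) < N := by exact_mod_cast (by omega : 0 < N)
  have hL : 0 < Real.log N := Real.log_pos (by exact_mod_cast (by omega : 1 < N))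
  set μ := ProbabilityTheory.gaussianReal
      (a / Real.log N) (Real.toNNReal (1 / (N * Real.log N ^ 2)))
  have hexp : ∀ t : ℝ, Integrable (fun s => Real.exp (t * s)) μ :=
    fun t => ProbabilityTheory.integrable_exp_mul_gaussianReal t
  have hmgf : ∀ t : ℝ, ∫ s, Real.exp (t * s) ∂μ =
      Real.exp (a / Real.log N * t + 1 / (N * Real.log N ^ 2) * t ^ 2 / 2) := by
    intro t
    have := congrFun (ProbabilityTheory.mgf_fun_id_gaussianReal (μ := a / Real.log N)
      (v := Real.toNNReal (1 / (N * Real.log N ^ 2)))) t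
    rw [Real.coe_toNNReal _ (by positivity)] at this
    exact this
  have hval : ∀ s, confiningPotential kappa N s =
      kappa / 2 * Real.exp (Real.log N * s) + kappa / 2 * Real.exp (-Real.log N * s) := by
    intro s
    rw [confiningPotential, Real.cosh_eq, neg_mul]
    ring
  rw [← ofReal_integral_eq_lintegral_ofReal]
  · congr 1
    simp_rw [hval]
    rw [integral_add ((hexp _).const_mul _) ((hexp _).const_mul _), integral_const_mul,
      integral_const_mul, hmgf, hmgf, Real.cosh_eq]
    have e1 : a / Real.log N * Real.log N + 1 / (N * Real.log N ^ 2) * Real.log N ^ 2 / 2 =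
        1 / (2 * N) + a := by field_simp; ring
    have e2 : a / Real.log N * -Real.log N + 1 / (N * Real.log N ^ 2) * (-Real.log N) ^ 2 / 2 =
        1 / (2 * N) + -a := by field_simp; ring
    rw [e1, e2, Real.exp_add, Real.exp_add]
    ring
  · rw [funext hval]
    exact ((hexp _).const_mul _).add ((hexp _).const_mul _)
  · exact ae_of_all _ fun s => mul_nonneg hk.le (Real.cosh_pos _).le

theorem norm_charFun_smearedMeasure_sq {N : ℕ} (hN : 2 ≤ N) (hcard : Fintype.card ι = N)
    (x : ι → ℝ) (y : ℝ) :
    ‖charFun (smearedMeasure N x) (Real.log N / π * y)‖ ^ 2 =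
      1 / (N : ℝ) ^ 2 * Real.exp (-(y ^ 2 / (N * π ^ 2))) *
        structureFactor (fun _ => 1) x y := by
  have hN0 : (0 : ℝ) < N := by exact_mod_cast (by omega : 0 < N)
  have hL : 0 < Real.log N := Real.log_pos (by exact_mod_cast (by omega : 1 < N))
  have hπ := Real.pi_pos
  rw [smearedMeasure, charFun_mixture, hcard]
  have h1 : ∀ i, charFun (ProbabilityTheory.gaussianReal (x i / Real.log N)
      (Real.toNNReal (1 / (N * Real.log N ^ 2)))) (Real.log N / π * y) =
      ((Real.exp (-(y ^ 2 / (2 * N * π ^ 2))) : ℝ) : ℂ) *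
        Complex.exp ((y * (x i / π) : ℝ) * Complex.I) := by
    intro i
    rw [ProbabilityTheory.charFun_gaussianReal, Real.coe_toNNReal _ (by positivity),
      Complex.ofReal_exp, ← Complex.exp_add]
    congr 1
    have e1 : Real.log N / π * y * (x i / Real.log N) = y * (x i / π) := by field_simp
    have e2 : 1 / (N * Real.log N ^ 2) * (Real.log N / π * y) ^ 2 / 2 =
        y ^ 2 / (2 * N * π ^ 2) := by field_simp
    rw [← e1, ← e2]
    push_cast
    ring
  simp_rw [h1]
  rw [← Finset.mul_sum, norm_mul, norm_mul, mul_pow, mul_pow, norm_sum_exp_sq, norm_inv,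
    Complex.norm_natCast, Complex.norm_real, Real.norm_of_nonneg (Real.exp_pos _).le,
    ← Real.exp_nat_mul]
  rw [show ((2 : ℕ) : ℝ) * -(y ^ 2 / (2 * N * π ^ 2)) = -(y ^ 2 / (N * π ^ 2)) by
    push_cast; field_simp]
  ring

/-- Completing the square: `y² / π² - y + π² / 4 ≥ 0`, and `π² / 4 ≤ 3`. This replaces the Gaussian
damping due to smearing by the Abel damping at `t = 1 / N`. -/
theorem exp_neg_sq_le {N : ℕ} (hN : 2 ≤ N) (y : ℝ) :
    Real.exp (-(y ^ 2 / (N * π ^ 2))) ≤ Real.exp (3 / N) * Real.exp (-(1 / N * y)) := by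
  have hN0 : (0 : ℝ) < N := by exact_mod_cast (by omega : 0 < N)
  have hπ := Real.pi_pos
  rw [← Real.exp_add, Real.exp_le_exp]
  have h1 : (y / π - π / 2) ^ 2 ≥ 0 := sq_nonneg _
  have h2 : (y / π - π / 2) ^ 2 = y ^ 2 / π ^ 2 - y + π ^ 2 / 4 := by field_simp; ring
  have h3 : π ^ 2 ≤ 12 := by nlinarith [Real.pi_lt_d2]
  have h4 : 0 ≤ y ^ 2 / π ^ 2 - y + 3 := by linarith
  have h5 : 3 / N + -(1 / N * y) - -(y ^ 2 / (N * π ^ 2)) = (y ^ 2 / π ^ 2 - y + 3) / N := by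
    field_simp
    ring
  have h6 := div_nonneg h4 hN0.le
  linarith

/-- Smearing removes the infinite self-energy of point masses. Its energy is compared with the
Abel-regularised sums mode by mode, using positivity of the amplitude and of the structure factor.
-/
theorem energyNN_smearedMeasure_le {b kappa : ℝ} (hb : 0 < b) (hb' : b < 1 / 2) (hk : 0 < kappa)
    {N : ℕ} (hN : 2 ≤ N) (hcard : Fintype.card ι = N) (x : ι → ℝ) :
    energyNN b kappa N (smearedMeasure N x) ≤
      ENNReal.ofReal (Real.exp (3 / N) / (N : ℝ) ^ 2 * configEnergy b kappa x) := by
  have hN0 : (0 : ℝ) < N := by exact_mod_cast (by omega : 0 < N)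
  have hf := isProfile_plusAmplitude hb hb'
  have ht : (0 : ℝ) < 1 / N := by positivity
  have hprob := isProbabilityMeasure_smearedMeasure N x (by omega)
  have h1 : ENNReal.ofReal (1 / N) *
      ∫⁻ s, ENNReal.ofReal (confiningPotential kappa N s) ∂(smearedMeasure N x) ≤
      ENNReal.ofReal (Real.exp (3 / N) / (N : ℝ) ^ 2 * (kappa * ∑ i, Real.cosh (x i))) := by
    have hcosh : 0 ≤ kappa * ∑ i, Real.cosh (x i) :=
      mul_nonneg hk.le (Finset.sum_nonneg fun i _ => (Real.cosh_pos _).le)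
    rw [smearedMeasure, lintegral_mixture]
    simp_rw [lintegral_confiningPotential_gaussianReal hk hN]
    rw [← ENNReal.ofReal_sum_of_nonneg fun i _ => by
      have := Real.cosh_pos (x i); positivity]
    rw [hcard, ← ENNReal.ofReal_natCast, ← ENNReal.ofReal_inv_of_pos hN0,
      ← ENNReal.ofReal_mul (by positivity), ← ENNReal.ofReal_mul (by positivity)]
    refine ENNReal.ofReal_le_ofReal ?_
    rw [← Finset.mul_sum, ← Finset.mul_sum]
    have h2 : Real.exp (1 / (2 * N)) ≤ Real.exp (3 / N) := by
      rw [Real.exp_le_exp, div_le_div_iff₀ (by positivity) hN0]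
      linarith
    calc _ = Real.exp (1 / (2 * N)) / (N : ℝ) ^ 2 * (kappa * ∑ i, Real.cosh (x i)) := by
          field_simp
      _ ≤ _ := by gcongr
  have h2 : ENNReal.ofReal (1 / 2) * fourierEnergy b (Real.log N / π) (smearedMeasure N x) ≤
      ENNReal.ofReal (Real.exp (3 / N) / (N : ℝ) ^ 2 * ∑ i, ∑ j,
        abelTransform (1 / 2) (plusAmplitude b) (1 / Fintype.card ι) ((x i - x j) / π)) := by
    have h3 := sum_mul_abelTransform hf ht (fun _ => 1) x
    simp only [one_mul, mul_one] at h3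
    rw [hcard, h3, ← integral_const_mul, fourierEnergy, ← lintegral_const_mul _ (by fun_prop),
      ofReal_integral_eq_lintegral_ofReal
        (Integrable.const_mul (hf.integrableOn_structureFactor ht _ x) _)]
    · refine setLIntegral_mono' measurableSet_Ioi fun y hy => ?_
      have hg := (plusAmplitude_pos hb hb' hy).le
      have hs := structureFactor_nonneg (fun _ => 1) x y
      rw [← ENNReal.ofReal_mul (by norm_num), norm_charFun_smearedMeasure_sq hN hcard]
      refine ENNReal.ofReal_le_ofReal ?_
      have h5 := exp_neg_sq_le hN y
      calc _ = plusAmplitude b y * (1 / (N : ℝ) ^ 2) * structureFactor (fun _ => 1) x y *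
            Real.exp (-(y ^ 2 / (N * π ^ 2))) := by ring
        _ ≤ plusAmplitude b y * (1 / (N : ℝ) ^ 2) * structureFactor (fun _ => 1) x y *
            (Real.exp (3 / N) * Real.exp (-(1 / N * y))) := by gcongr
        _ = _ := by ring
    · filter_upwards [ae_restrict_mem measurableSet_Ioi] with y hy
      have hg := (plusAmplitude_pos hb hb' hy).le
      have hs := structureFactor_nonneg (fun _ => 1) x y
      simp only [Pi.zero_apply]
      positivity
  rw [energyNN, configEnergy, mul_add, ENNReal.ofReal_add]
  · exact add_le_add h1 h2
  · have : 0 ≤ ∑ i, Real.cosh (x i) := Finset.sum_nonneg fun i _ => (Real.cosh_pos _).le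
    positivity
  · have h3 := sum_mul_abelTransform_nonneg hf (fun y hy => (plusAmplitude_pos hb hb' hy).le) ht
      (fun _ => 1) x
    simp only [one_mul] at h3
    rw [hcard]
    positivity

end Configurations

/-! ### Reduction of the two-component interaction to one component. -/

theorem abelTransform_neg (κ : ℝ) (f : ℝ → ℝ) (t c : ℝ) :
    abelTransform κ f t (-c) = abelTransform κ f t c := by
  simp only [abelTransform, neg_sq, neg_mul, Real.cos_neg]

theorem sum_Ioi_eq {n : ℕ} (K : ℝ → ℝ) (hK : ∀ u, K (-u) = K u) (x : Fin n → ℝ) :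
    ∑ i, ∑ j ∈ Finset.Ioi i, K (x i - x j) =
      1 / 2 * (∑ i, ∑ j, K (x i - x j)) - 1 / 2 * (n * K 0) := by
  have h1 := Finset.sum_sum_Ioi_add_eq_sum_sum_off_diag (fun i j => K (x i - x j))
  have h3 : ∀ i j, K (x j - x i) = K (x i - x j) := fun i j => by rw [← hK, neg_sub]
  have h2 : ∀ i, ∑ j ∈ {i}ᶜ, K (x j - x i) = ∑ j, K (x i - x j) - K 0 := by
    intro i
    rw [eq_sub_iff_add_eq, add_comm, ← sub_self (x i), Finset.sum_congr rfl fun j _ => h3 i j]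
    exact Fintype.sum_eq_add_sum_compl i (fun j => K (x i - x j)) |>.symm
  rw [Finset.sum_congr rfl fun i _ => h2 i, Finset.sum_congr rfl fun i _ =>
    Finset.sum_congr rfl fun j _ => show _ = 2 * K (x i - x j) by rw [h3, two_mul]] at h1
  simp only [← Finset.mul_sum, Finset.sum_sub_distrib, Finset.sum_const,
    Finset.card_univ, Fintype.card_fin, nsmul_eq_mul] at h1
  linarith

theorem abelTransform_one_div_le {κ : ℝ} {f : ℝ → ℝ} (hf : IsProfile κ f) (hκ : 0 ≤ κ) {N : ℕ}
    (hN : 2 ≤ N) :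
    abelTransform κ f (1 / N) 0 ≤
      2 * κ * Real.log N + ∫ x in Set.Ioi (0 : ℝ), |profileRem κ f x| := by
  have hN2 : (2 : ℝ) ≤ N := by exact_mod_cast hN
  have hN0 : (0 : ℝ) < N := by linarith
  refine add_le_add ?_ ?_
  -- The quotient equals `(N + 1)²`, and `N + 1 ≤ N²` for `N ≥ 2`.
  · have h1 : ((1 + 1 / (N : ℝ)) ^ 2 + 0 ^ 2) / ((1 / (N : ℝ)) ^ 2 + 0 ^ 2) ≤ (N : ℝ) ^ 4 := by
      have : ((1 + 1 / (N : ℝ)) ^ 2 + 0 ^ 2) / ((1 / (N : ℝ)) ^ 2 + 0 ^ 2) = (N + 1 : ℝ) ^ 2 := by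
        field_simp
        ring
      rw [this, show (N : ℝ) ^ 4 = (N ^ 2) ^ 2 by ring]
      gcongr
      nlinarith
    have h2 := Real.log_le_log (by positivity) h1
    rw [Real.log_pow] at h2
    push_cast at h2
    nlinarith [mul_le_mul_of_nonneg_left h2 (by linarith : 0 ≤ κ / 2)]
  · refine setIntegral_mono_on (integrableOn_mul_exp_mul_cos hf.rem (by positivity) 0) hf.rem.abs
      measurableSet_Ioi fun x hx => ?_
    refine (le_abs_self _).trans ?_
    rw [abs_mul]
    exact mul_le_of_le_one_right (abs_nonneg _) (abs_exp_mul_cos_le (by positivity) hx 0)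

/-- The value of `pairPotential` at the origin is uncontrolled, so coincidences within one type are
excluded; they lie in a finite union of hyperplanes. -/
theorem ae_injective (n : ℕ) : ∀ᵐ x : Fin n → ℝ, ∀ i j, i ≠ j → x i ≠ x j := by
  refine ae_all_iff.2 fun i => ae_all_iff.2 fun j => ?_
  by_cases hij : i = j
  · simp [hij]
  let V : Submodule ℝ (Fin n → ℝ) :=
    LinearMap.ker (LinearMap.proj (R := ℝ) (φ := fun _ : Fin n => ℝ) i - LinearMap.proj j)
  have hV : V ≠ ⊤ := by
    intro h
    have : Pi.single i (1 : ℝ) ∈ V := h ▸ Submodule.mem_top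
    simp [V, LinearMap.mem_ker, Pi.single_eq_of_ne (Ne.symm hij)] at this
  have h0 := Measure.addHaar_submodule (volume : Measure (Fin n → ℝ)) V hV
  rw [ae_iff]
  refine measure_mono_null (fun x hx => ?_) h0
  simp only [Classical.not_imp, not_not, Set.mem_ofPred_eq] at hx
  simp [V, LinearMap.mem_ker, hx.2]

/-- The regularised potential bounding the interaction of two particles, of the same type for
`ε = 1` and of different types for `ε = -1`. -/
def regPotential (b C t ε u : ℝ) : ℝ :=
  -2 * abelTransform (1 / 2) (plusAmplitude b) t (u / π) -
    ε * abelTransform 1 (crossAmplitude b) t (u / π) + C * t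

theorem regPotential_neg (b C t ε u : ℝ) : regPotential b C t ε (-u) = regPotential b C t ε u := by
  simp only [regPotential, neg_div, abelTransform_neg]

section

variable {b : ℝ} (hb : 0 < b) (hb' : b < 1 / 2)

include hb hb'

/-- The near-monotonicity is applied to the combined amplitude `plus ± cross / 2`, whose coefficient
at infinity is `1` or `0`. Treating the two transforms separately would fail for mixed pairs, where
`T[cross]` enters with the unfavourable sign. -/
theorem exists_le_regPotential : ∃ C : ℝ, 0 ≤ C ∧ ∀ t : ℝ, 0 < t → t ≤ 1 →
    (∀ u : ℝ, u ≠ 0 → Real.exp (pairPotential b u) ≤ Real.exp (regPotential b C t 1 u)) ∧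
    (∀ u : ℝ, 0 ≤ Real.exp (pairPotential b u) * crossFactor b u ∧
      Real.exp (pairPotential b u) * crossFactor b u ≤ Real.exp (regPotential b C t (-1) u)) := by
  have hg := isProfile_plusAmplitude hb hb'
  have hh := isProfile_crossAmplitude hb hb'
  have key : ∀ ε : ℝ, 0 ≤ 1 / 2 + ε / 2 * 1 → ∃ C : ℝ, 0 ≤ C ∧ ∀ t : ℝ, 0 < t → t ≤ 1 →
      ∀ u : ℝ, u ≠ 0 → -2 * abelTransform (1 / 2) (plusAmplitude b) 0 (u / π) -
        ε * abelTransform 1 (crossAmplitude b) 0 (u / π) ≤ regPotential b C t ε u := by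
    intro ε hε
    have hf := hg.add (hh.const_mul (ε / 2))
    refine ⟨2 * abelLoss (1 / 2 + ε / 2 * 1)
      (fun x => plusAmplitude b x + ε / 2 * crossAmplitude b x),
      mul_nonneg zero_le_two (abelLoss_nonneg hε _), fun t ht ht1 u hu => ?_⟩
    have hc : u / π ≠ 0 := div_ne_zero hu Real.pi_ne_zero
    have h1 := hf.le_abelTransform_zero (c := u / π) hε le_rfl ht.le ht1 (by positivity)
    rw [← abelLoss, abelTransform_add hg (hh.const_mul _) le_rfl,
      abelTransform_add hg (hh.const_mul _) ht.le, abelTransform_const_mul,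
      abelTransform_const_mul, sub_zero] at h1
    unfold regPotential
    linarith
  obtain ⟨C₁, hC₁, h₁⟩ := key 1 (by norm_num)
  obtain ⟨C₂, hC₂, h₂⟩ := key (-1) (by norm_num)
  have hmono : ∀ C C' t ε u : ℝ, 0 ≤ t → C ≤ C' →
      regPotential b C t ε u ≤ regPotential b C' t ε u := by
    intro C C' t ε u ht hC
    unfold regPotential
    have := mul_le_mul_of_nonneg_right hC ht
    linarith
  refine ⟨C₁ + C₂, add_nonneg hC₁ hC₂, fun t ht ht1 => ⟨fun u hu => ?_, fun u => ?_⟩⟩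
  · rw [Real.exp_le_exp, pairPotential_eq hb hb' hu]
    refine le_trans ?_ ((h₁ t ht ht1 u hu).trans (hmono _ _ _ _ _ ht.le (by linarith)))
    linarith
  · rcases eq_or_ne u 0 with rfl | hu
    -- Division by zero makes the mixed factor vanish at coinciding points, so these need no
    -- exclusion.
    · have : crossFactor b 0 = 0 := by simp [crossFactor_eq]
      rw [this, mul_zero]
      exact ⟨le_rfl, (Real.exp_pos _).le⟩
    · have hpos := crossFactor_pos b hu
      refine ⟨by positivity, ?_⟩
      rw [← Real.exp_log hpos, ← Real.exp_add, Real.exp_le_exp, pairPotential_eq hb hb' hu,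
        log_crossFactor hb hb' hu]
      refine le_trans ?_ ((h₂ t ht ht1 u hu).trans (hmono _ _ _ _ _ ht.le (by linarith)))
      linarith

/-- Positive definiteness bounds the regularised interaction of a two-component configuration. -/
theorem sum_regPotential_le {p q : ℕ} (hpq : p + q ≠ 0) {C : ℝ} (hC : 0 ≤ C)
    (ν : Fin p → ℝ) (l : Fin q → ℝ) {t : ℝ} (ht : t = 1 / (p + q : ℕ)) :
    ∑ i, ∑ j ∈ Finset.Ioi i, regPotential b C t 1 (ν i - ν j) +
      ∑ i, ∑ j ∈ Finset.Ioi i, regPotential b C t 1 (l i - l j) +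
      ∑ i, ∑ j, regPotential b C t (-1) (ν i - l j) ≤
    -(∑ i, ∑ j, abelTransform (1 / 2) (plusAmplitude b) t
      ((Sum.elim ν l i - Sum.elim ν l j) / π)) +
      (p + q : ℕ) * (abelTransform (1 / 2) (plusAmplitude b) t 0 +
        1 / 2 * abelTransform 1 (crossAmplitude b) t 0 + C / 2) := by
  have hN : (0 : ℝ) < (p + q : ℕ) := by exact_mod_cast Nat.pos_of_ne_zero hpq
  have ht0 : 0 < t := by rw [ht]; positivity
  set ε : Fin p ⊕ Fin q → ℝ := Sum.elim (fun _ => 1) (fun _ => -1)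
  -- With these signs the coefficient of `T[cross]` is `-εᵢ εⱼ` for every pair, so the full double
  -- sum has a sign.
  have hpos := sum_mul_abelTransform_nonneg (isProfile_crossAmplitude hb hb')
    (fun y hy => (crossAmplitude_pos hb hb' hy).le) ht0 ε (Sum.elim ν l)
  have hK : ∀ u, regPotential b C t 1 (-u) = regPotential b C t 1 u := regPotential_neg b C t 1
  rw [sum_Ioi_eq _ hK, sum_Ioi_eq _ hK]
  have hsym : ∑ i, ∑ j, regPotential b C t (-1) (l i - ν j) =
      ∑ i, ∑ j, regPotential b C t (-1) (ν i - l j) := by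
    rw [Finset.sum_comm]
    refine Finset.sum_congr rfl fun i _ => Finset.sum_congr rfl fun j _ => ?_
    rw [← regPotential_neg, neg_sub]
  have htot : ∑ i, ∑ j, regPotential b C t (ε i * ε j) (Sum.elim ν l i - Sum.elim ν l j) =
      ∑ i, ∑ j, regPotential b C t 1 (ν i - ν j) + ∑ i, ∑ j, regPotential b C t 1 (l i - l j) +
        2 * ∑ i, ∑ j, regPotential b C t (-1) (ν i - l j) := by
    simp only [Fintype.sum_sum_type, Sum.elim_inl, Sum.elim_inr, Finset.sum_add_distrib, ε]
    norm_num only [mul_one, one_mul, neg_mul_neg, mul_neg]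
    rw [hsym]
    ring
  -- The loss `C t` over all `(p + q)²` ordered pairs amounts to `(p + q) C`, as `t = 1 / (p + q)`.
  have htot2 : ∑ i, ∑ j, regPotential b C t (ε i * ε j) (Sum.elim ν l i - Sum.elim ν l j) =
      -2 * (∑ i, ∑ j, abelTransform (1 / 2) (plusAmplitude b) t
        ((Sum.elim ν l i - Sum.elim ν l j) / π)) -
      (∑ i, ∑ j, ε i * ε j * abelTransform 1 (crossAmplitude b) t
        ((Sum.elim ν l i - Sum.elim ν l j) / π)) + (p + q : ℕ) * C := by
    simp only [regPotential, Finset.sum_add_distrib, Finset.sum_sub_distrib, ← Finset.mul_sum,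
      Finset.sum_const, Finset.card_univ, Fintype.card_sum, Fintype.card_fin, nsmul_eq_mul]
    rw [ht]
    field_simp
  have hK0 : regPotential b C t 1 0 = -2 * abelTransform (1 / 2) (plusAmplitude b) t 0 -
      abelTransform 1 (crossAmplitude b) t 0 + C * t := by
    simp [regPotential]
  have hCt : 0 ≤ C * t := by positivity
  rw [hK0]
  push_cast at *
  nlinarith [mul_nonneg hN.le hCt]

theorem exists_partitionIntegrand_le {kappa : ℝ} : ∃ C : ℝ, 0 ≤ C ∧ ∀ p q : ℕ, 2 ≤ p + q →
    ∀ (ν : Fin p → ℝ) (l : Fin q → ℝ), (∀ i j, i ≠ j → ν i ≠ ν j) → (∀ i j, i ≠ j → l i ≠ l j) →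
    partitionIntegrand b kappa ν l ≤ Real.exp (-configEnergy b kappa (Sum.elim ν l) +
      (p + q : ℕ) * (2 * Real.log (p + q : ℕ) + C)) := by
  obtain ⟨C, hC, hle⟩ := exists_le_regPotential hb hb'
  have hg := isProfile_plusAmplitude hb hb'
  have hh := isProfile_crossAmplitude hb hb'
  refine ⟨(∫ x in Set.Ioi (0 : ℝ), |profileRem (1 / 2) (plusAmplitude b) x|) +
    1 / 2 * (∫ x in Set.Ioi (0 : ℝ), |profileRem 1 (crossAmplitude b) x|) + C / 2, ?_, ?_⟩
  · have h1 : 0 ≤ ∫ x in Set.Ioi (0 : ℝ), |profileRem (1 / 2) (plusAmplitude b) x| :=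
      integral_nonneg fun _ => abs_nonneg _
    have h2 : 0 ≤ ∫ x in Set.Ioi (0 : ℝ), |profileRem 1 (crossAmplitude b) x| :=
      integral_nonneg fun _ => abs_nonneg _
    positivity
  intro p q hpq ν l hν hl
  have hN2 : (2 : ℝ) ≤ (p + q : ℕ) := by exact_mod_cast hpq
  have hN0 : (0 : ℝ) < (p + q : ℕ) := by linarith
  obtain ⟨hsame, hcross⟩ := hle (1 / (p + q : ℕ)) (by positivity)
    (by rw [div_le_one hN0]; linarith)
  set t : ℝ := 1 / (p + q : ℕ) with ht
  have hP : ∀ {n : ℕ} (x : Fin n → ℝ), (∀ i j, i ≠ j → x i ≠ x j) →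
      ∏ i, ∏ j ∈ Finset.Ioi i, Real.exp (pairPotential b (x i - x j)) ≤
      Real.exp (∑ i, ∑ j ∈ Finset.Ioi i, regPotential b C t 1 (x i - x j)) := by
    intro n x hx
    rw [Real.exp_sum]
    refine Finset.prod_le_prod (fun i _ => Finset.prod_nonneg fun j _ => (Real.exp_pos _).le)
      fun i _ => ?_
    rw [Real.exp_sum]
    refine Finset.prod_le_prod (fun j _ => (Real.exp_pos _).le) fun j hj => ?_
    exact hsame _ (sub_ne_zero.2 (hx i j (Finset.mem_Ioi.1 hj).ne))
  have hQ : ∏ i, ∏ j, (Real.exp (pairPotential b (ν i - l j)) * crossFactor b (ν i - l j)) ≤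
      Real.exp (∑ i, ∑ j, regPotential b C t (-1) (ν i - l j)) := by
    rw [Real.exp_sum]
    refine Finset.prod_le_prod (fun i _ => Finset.prod_nonneg fun j _ => (hcross _).1)
      fun i _ => ?_
    rw [Real.exp_sum]
    exact Finset.prod_le_prod (fun j _ => (hcross _).1) fun j _ => (hcross _).2
  have hQ0 : 0 ≤ ∏ i, ∏ j, (Real.exp (pairPotential b (ν i - l j)) * crossFactor b (ν i - l j)) :=
    Finset.prod_nonneg fun i _ => Finset.prod_nonneg fun j _ => (hcross _).1
  have hsum := sum_regPotential_le hb hb' (by omega) hC ν l ht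
  have hG := abelTransform_one_div_le hg (by norm_num) hpq
  have hH := abelTransform_one_div_le hh zero_le_one hpq
  rw [← ht] at hG hH
  calc partitionIntegrand b kappa ν l ≤
      Real.exp (∑ i, -kappa * Real.cosh (ν i)) * Real.exp (∑ i, -kappa * Real.cosh (l i)) *
      Real.exp (∑ i, ∑ j ∈ Finset.Ioi i, regPotential b C t 1 (ν i - ν j)) *
      Real.exp (∑ i, ∑ j ∈ Finset.Ioi i, regPotential b C t 1 (l i - l j)) *
      Real.exp (∑ i, ∑ j, regPotential b C t (-1) (ν i - l j)) := by
        unfold partitionIntegrand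
        rw [Real.exp_sum, Real.exp_sum]
        gcongr
        · exact hP ν hν
        · exact hP l hl
    _ ≤ _ := by
        rw [← Real.exp_add, ← Real.exp_add, ← Real.exp_add, ← Real.exp_add, Real.exp_le_exp]
        have hcfg : configEnergy b kappa (Sum.elim ν l) =
            kappa * ∑ i, Real.cosh (ν i) + kappa * ∑ i, Real.cosh (l i) +
            ∑ i, ∑ j, abelTransform (1 / 2) (plusAmplitude b) t
              ((Sum.elim ν l i - Sum.elim ν l j) / π) := by
          rw [configEnergy, Fintype.card_sum, Fintype.card_fin, Fintype.card_fin, ← ht]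
          simp only [Fintype.sum_sum_type (fun i => Real.cosh (Sum.elim ν l i)), Sum.elim_inl,
            Sum.elim_inr]
          ring
        rw [hcfg, ← Finset.mul_sum, ← Finset.mul_sum]
        have := mul_le_mul_of_nonneg_left (add_le_add hG (mul_le_mul_of_nonneg_left hH
          (by norm_num : (0 : ℝ) ≤ 1 / 2))) hN0.le
        nlinarith

end

/-! ### Comparison with the minimum and integration over configurations. -/

theorem sq_div_two_le_cosh (x : ℝ) : x ^ 2 / 2 ≤ Real.cosh x := by
  have h1 := Real.self_le_sinh_iff.2 (by positivity : 0 ≤ |x| / 2)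
  have h2 : Real.cosh x = 1 + 2 * Real.sinh (|x| / 2) ^ 2 := by
    rw [← Real.cosh_abs, show |x| = 2 * (|x| / 2) by ring, Real.cosh_two_mul, Real.cosh_sq]
    ring_nf
  have h3 := pow_le_pow_left₀ (by positivity) h1 2
  rw [div_pow, sq_abs] at h3
  linarith

theorem lintegral_prod_gaussian {a : ℝ} (ha : 0 < a) (n : ℕ) :
    ∫⁻ x : Fin n → ℝ, ENNReal.ofReal (∏ i, Real.exp (-a * x i ^ 2)) =
      ENNReal.ofReal (√(π / a) ^ n) := by
  have h := Integrable.fintype_prod (ι := Fin n) (μ := fun _ => (volume : Measure ℝ))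
    (f := fun _ x => Real.exp (-a * x ^ 2)) fun _ => integrable_exp_neg_mul_sq ha
  have h2 := ofReal_integral_eq_lintegral_ofReal (μ := (volume : Measure (Fin n → ℝ))) h
    (ae_of_all _ fun x => Finset.prod_nonneg fun i _ => (Real.exp_pos _).le)
  rw [← h2,
    integral_fintype_prod_volume_eq_pow (fun x : ℝ => Real.exp (-a * x ^ 2)), integral_gaussian,
    Fintype.card_fin]

section

variable {b kappa : ℝ} (hb : 0 < b) (hb' : b < 1 / 2)

include hb hb'

theorem kappa_mul_sum_cosh_le_configEnergy {ι : Type*} [Fintype ι] (hι : 0 < Fintype.card ι)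
    (x : ι → ℝ) : kappa * ∑ i, Real.cosh (x i) ≤ configEnergy b kappa x := by
  have hN : (0 : ℝ) < Fintype.card ι := by exact_mod_cast hι
  have h := sum_mul_abelTransform_nonneg (isProfile_plusAmplitude hb hb')
    (fun y hy => (plusAmplitude_pos hb hb' hy).le) (t := 1 / Fintype.card ι) (by positivity)
    (fun _ => 1) x
  simp only [one_mul] at h
  unfold configEnergy
  linarith

variable (hk : 0 < kappa)

include hk

/-- The smeared empirical measure is a competitor in the minimisation. -/
theorem sq_mul_toReal_le_configEnergy {ι : Type*} [Fintype ι] {N : ℕ} (hN : 2 ≤ N)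
    (hcard : Fintype.card ι = N) {e : ℝ≥0∞}
    (he : ∀ σ : ProbabilityMeasure ℝ, e ≤ energyNN b kappa N σ) (x : ι → ℝ) :
    (N : ℝ) ^ 2 * e.toReal ≤ Real.exp (3 / N) * configEnergy b kappa x := by
  have hN0 : (0 : ℝ) < N := by exact_mod_cast (by omega : 0 < N)
  have h0 : 0 ≤ configEnergy b kappa x :=
    (mul_nonneg hk.le (Finset.sum_nonneg fun i _ => (Real.cosh_pos _).le)).trans
      (kappa_mul_sum_cosh_le_configEnergy hb hb' (by omega) x)
  have h1 := (he ⟨smearedMeasure N x, isProbabilityMeasure_smearedMeasure N x (by omega)⟩).trans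
    (energyNN_smearedMeasure_le hb hb' hk hN hcard x)
  have h2 := ENNReal.toReal_mono ENNReal.ofReal_ne_top h1
  rw [ENNReal.toReal_ofReal (by positivity)] at h2
  calc (N : ℝ) ^ 2 * e.toReal ≤
      (N : ℝ) ^ 2 * (Real.exp (3 / N) / (N : ℝ) ^ 2 * configEnergy b kappa x) := by gcongr
    _ = _ := by field_simp

/-- Placing all particles at the origin and smearing gives a competitor of energy `O(log N)`. This
keeps the multiplicative errors `1 + O(1 / N)` affordable. -/
theorem toReal_minimum_le {N : ℕ} (hN : 2 ≤ N) {e : ℝ≥0∞}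
    (he : ∀ σ : ProbabilityMeasure ℝ, e ≤ energyNN b kappa N σ) :
    e.toReal ≤ Real.exp 3 * (kappa + Real.log N +
      ∫ x in Set.Ioi (0 : ℝ), |profileRem (1 / 2) (plusAmplitude b) x|) := by
  have hN2 : (2 : ℝ) ≤ N := by exact_mod_cast hN
  have hN0 : (0 : ℝ) < N := by linarith
  have h1 := sq_mul_toReal_le_configEnergy hb hb' hk hN (Fintype.card_fin N) he (fun _ => 0)
  have hG := abelTransform_one_div_le (isProfile_plusAmplitude hb hb') (by norm_num) hN
  have hcfg : configEnergy b kappa (fun _ : Fin N => 0) = kappa * N +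
      (N : ℝ) ^ 2 * abelTransform (1 / 2) (plusAmplitude b) (1 / N) 0 := by
    simp [configEnergy]
    ring
  have h0 : 0 ≤ configEnergy b kappa (fun _ : Fin N => 0) :=
    (mul_nonneg hk.le (Finset.sum_nonneg fun i _ => (Real.cosh_pos _).le)).trans
      (kappa_mul_sum_cosh_le_configEnergy hb hb' (by simp; omega) _)
  have h3 : Real.exp (3 / N) ≤ Real.exp 3 := by
    rw [Real.exp_le_exp, div_le_iff₀ hN0]; linarith
  have h4 := h1.trans (mul_le_mul_of_nonneg_right h3 h0)
  have h5 : configEnergy b kappa (fun _ : Fin N => 0) ≤ (N : ℝ) ^ 2 * (kappa + Real.log N +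
      ∫ x in Set.Ioi (0 : ℝ), |profileRem (1 / 2) (plusAmplitude b) x|) := by
    rw [hcfg]
    have h6 : kappa * N ≤ kappa * (N : ℝ) ^ 2 := by
      have : (N : ℝ) ≤ (N : ℝ) ^ 2 := by nlinarith
      gcongr
    have h7 := mul_le_mul_of_nonneg_left hG (by positivity : 0 ≤ (N : ℝ) ^ 2)
    linarith
  have h8 := h4.trans (mul_le_mul_of_nonneg_left h5 (Real.exp_pos 3).le)
  refine le_of_mul_le_mul_left ?_ (by positivity : 0 < (N : ℝ) ^ 2)
  linarith

/-- The energy is split with weights `1 - 1 / N` and `1 / N`. The first share yields the minimum;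
the second, through `cosh x ≥ x² / 2`, yields Gaussian decay. -/
theorem neg_configEnergy_le {ι : Type*} [Fintype ι] {N : ℕ} (hN : 2 ≤ N)
    (hcard : Fintype.card ι = N) {e : ℝ≥0∞}
    (he : ∀ σ : ProbabilityMeasure ℝ, e ≤ energyNN b kappa N σ) (x : ι → ℝ) :
    -configEnergy b kappa x ≤ -(N : ℝ) ^ 2 * e.toReal + 4 * N * e.toReal +
      ∑ i, -(kappa / (2 * N)) * x i ^ 2 := by
  have hN2 : (2 : ℝ) ≤ N := by exact_mod_cast hN
  have hN0 : (0 : ℝ) < N := by linarith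
  have h1 := sq_mul_toReal_le_configEnergy hb hb' hk hN hcard he x
  have h2 := kappa_mul_sum_cosh_le_configEnergy (kappa := kappa) hb hb' (by omega) x
  have hm : 0 ≤ e.toReal := ENNReal.toReal_nonneg
  set R := configEnergy b kappa x
  have h3 : (1 - 3 / N) * ((N : ℝ) ^ 2 * e.toReal) ≤ R := by
    -- At `N = 2` the left side is negative, which does no harm.
    have h4 : (1 - 3 / N : ℝ) ≤ Real.exp (-(3 / N)) := by
      linarith [Real.add_one_le_exp (-(3 / N : ℝ))]
    have h5 := mul_le_mul_of_nonneg_left h1 (Real.exp_pos (-(3 / N))).le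
    rw [← mul_assoc _ (Real.exp (3 / N)), ← Real.exp_add, neg_add_cancel, Real.exp_zero, one_mul] at h5
    exact (mul_le_mul_of_nonneg_right h4 (by positivity)).trans h5
  have h6 : ∑ i, -(kappa / (2 * N)) * x i ^ 2 ≥ -(1 / N * R) := by
    have h7 : ∑ i, -(kappa / (2 * N)) * x i ^ 2 ≥ -(1 / N * (kappa * ∑ i, Real.cosh (x i))) := by
      rw [Finset.mul_sum, Finset.mul_sum, ← Finset.sum_neg_distrib]
      refine Finset.sum_le_sum fun i _ => ?_
      have h8 := mul_le_mul_of_nonneg_left (sq_div_two_le_cosh (x i))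
        (by positivity : 0 ≤ kappa / N)
      have e1 : 1 / N * (kappa * Real.cosh (x i)) = kappa / N * Real.cosh (x i) := by ring
      have e2 : kappa / (2 * N) * x i ^ 2 = kappa / N * (x i ^ 2 / 2) := by field_simp
      rw [neg_mul, e1, e2]
      linarith
    have h9 := mul_le_mul_of_nonneg_left h2 (by positivity : (0 : ℝ) ≤ 1 / N)
    linarith
  have h10 : (0 : ℝ) ≤ 1 - 1 / N := by
    rw [sub_nonneg, div_le_one hN0]; linarith
  have h11 := mul_le_mul_of_nonneg_left h3 h10
  have h12 : (1 - 1 / (N : ℝ)) * ((1 - 3 / N) * ((N : ℝ) ^ 2 * e.toReal)) =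
      (N : ℝ) ^ 2 * e.toReal - 4 * N * e.toReal + 3 * e.toReal := by
    field_simp
    ring
  nlinarith

theorem partitionFunction_le {C : ℝ} (hC : ∀ p q : ℕ, 2 ≤ p + q →
    ∀ (ν : Fin p → ℝ) (l : Fin q → ℝ), (∀ i j, i ≠ j → ν i ≠ ν j) → (∀ i j, i ≠ j → l i ≠ l j) →
    partitionIntegrand b kappa ν l ≤ Real.exp (-configEnergy b kappa (Sum.elim ν l) +
      (p + q : ℕ) * (2 * Real.log (p + q : ℕ) + C))) {N p : ℕ} (hN : 2 ≤ N) (hp : p ≤ N)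
    {e : ℝ≥0∞} (he : ∀ σ : ProbabilityMeasure ℝ, e ≤ energyNN b kappa N σ) :
    partitionFunction b kappa N p ≤ ENNReal.ofReal ((1 / Real.log N) ^ N *
      (Real.exp (-(N : ℝ) ^ 2 * e.toReal + 4 * N * e.toReal + N * (2 * Real.log N + C)) *
        √(π / (kappa / (2 * N))) ^ N)) := by
  have hN0 : (0 : ℝ) < N := by exact_mod_cast (by omega : 0 < N)
  have hL : 0 < Real.log N := Real.log_pos (by exact_mod_cast (by omega : 1 < N))
  obtain ⟨q, rfl⟩ := Nat.exists_eq_add_of_le hp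
  have ha : 0 < kappa / (2 * (p + q : ℕ)) := by positivity
  rw [partitionFunction, Nat.add_sub_cancel_left, ENNReal.ofReal_mul (by positivity)]
  gcongr
  set A := -((p + q : ℕ) : ℝ) ^ 2 * e.toReal + 4 * (p + q : ℕ) * e.toReal +
    (p + q : ℕ) * (2 * Real.log (p + q : ℕ) + C)
  set a := kappa / (2 * (p + q : ℕ))
  have hpt : ∀ (ν : Fin p → ℝ) (l : Fin q → ℝ), (∀ i j, i ≠ j → ν i ≠ ν j) →
      (∀ i j, i ≠ j → l i ≠ l j) → partitionIntegrand b kappa ν l ≤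
        Real.exp A * (∏ i, Real.exp (-a * ν i ^ 2)) * ∏ i, Real.exp (-a * l i ^ 2) := by
    intro ν l hν hl
    refine (hC p q hN ν l hν hl).trans ?_
    rw [← Real.exp_sum, ← Real.exp_sum, ← Real.exp_add, ← Real.exp_add, Real.exp_le_exp]
    have h := neg_configEnergy_le hb hb' hk hN (by simp) he (Sum.elim ν l)
    rw [Fintype.sum_sum_type] at h
    simp only [Sum.elim_inl, Sum.elim_inr] at h
    linarith
  have hprod : ∀ {n : ℕ} (x : Fin n → ℝ), 0 ≤ ∏ i, Real.exp (-a * x i ^ 2) := fun x =>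
    Finset.prod_nonneg fun i _ => (Real.exp_pos _).le
  calc ∫⁻ ν : Fin p → ℝ, ∫⁻ l : Fin q → ℝ, ENNReal.ofReal (partitionIntegrand b kappa ν l) ≤
      ∫⁻ ν : Fin p → ℝ, ∫⁻ l : Fin q → ℝ, ENNReal.ofReal
        (Real.exp A * (∏ i, Real.exp (-a * ν i ^ 2))) *
          ENNReal.ofReal (∏ i, Real.exp (-a * l i ^ 2)) := by
        refine lintegral_mono_ae ?_
        filter_upwards [ae_injective p] with ν hν
        refine lintegral_mono_ae ?_
        filter_upwards [ae_injective q] with l hl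
        rw [← ENNReal.ofReal_mul (mul_nonneg (Real.exp_pos _).le (hprod ν))]
        exact ENNReal.ofReal_le_ofReal (hpt ν l hν hl)
    _ = ∫⁻ ν : Fin p → ℝ, ENNReal.ofReal (Real.exp A) *
          ENNReal.ofReal (∏ i, Real.exp (-a * ν i ^ 2)) * ENNReal.ofReal (√(π / a) ^ q) := by
        refine lintegral_congr fun ν => ?_
        rw [lintegral_const_mul' _ _ ENNReal.ofReal_ne_top, lintegral_prod_gaussian ha,
          ENNReal.ofReal_mul (Real.exp_pos _).le]
    _ = ENNReal.ofReal (Real.exp A * √(π / a) ^ (p + q)) := by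
        rw [lintegral_mul_const' _ _ ENNReal.ofReal_ne_top,
          lintegral_const_mul' _ _ ENNReal.ofReal_ne_top, lintegral_prod_gaussian ha,
          ← ENNReal.ofReal_mul (Real.exp_pos _).le, ← ENNReal.ofReal_mul (by positivity), pow_add,
          mul_assoc]

end

/-- Each particle contributes `√(2πN / κ) / log N`, that is `exp (O(log N))`; `log N ≥ 1/2` bounds
the inverse logarithm by `e`. -/
theorem inv_log_pow_mul_sqrt_pow_le {kappa : ℝ} (hk : 0 < kappa) {N : ℕ} (hN : 2 ≤ N) :
    (1 / Real.log N) ^ N * √(π / (kappa / (2 * N))) ^ N ≤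
      Real.exp (N * (1 + (|Real.log (2 * π / kappa)| + Real.log N) / 2)) := by
  have hN2 : (2 : ℝ) ≤ N := by exact_mod_cast hN
  have hN0 : (0 : ℝ) < N := by linarith
  have hL : 1 / 2 ≤ Real.log N := by
    have := Real.log_le_log two_pos hN2
    linarith [Real.log_two_gt_d9]
  have hL0 : 0 < Real.log N := by linarith
  rw [← mul_pow, Real.exp_nat_mul, Real.exp_add]
  have h1 : 1 / Real.log N ≤ Real.exp 1 := by
    rw [div_le_iff₀ hL0]
    have := Real.add_one_le_exp (1 : ℝ)
    nlinarith
  have h2 : √(π / (kappa / (2 * N))) ≤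
      Real.exp ((|Real.log (2 * π / kappa)| + Real.log N) / 2) := by
    have hpos : 0 < 2 * π / kappa := by have := Real.pi_pos; positivity
    rw [Real.sqrt_le_left (Real.exp_pos _).le, ← Real.exp_nat_mul]
    have e1 : π / (kappa / (2 * N)) = 2 * π / kappa * N := by field_simp
    have e2 : ((2 : ℕ) : ℝ) * ((|Real.log (2 * π / kappa)| + Real.log N) / 2) =
        |Real.log (2 * π / kappa)| + Real.log N := by push_cast; ring
    rw [e1, e2, Real.exp_add, Real.exp_log hN0]
    gcongr
    calc 2 * π / kappa = Real.exp (Real.log (2 * π / kappa)) := (Real.exp_log hpos).symm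
      _ ≤ _ := Real.exp_le_exp.2 (le_abs_self _)
  gcongr

end

end SinhGordon

theorem mainTheorem5 (b kappa : ℝ) (hb : 0 < b) (hb' : b < 1 / 2) (hkappa : 0 < kappa) :
    ∃ C : ℝ, 0 < C ∧ ∀ N : ℕ, 2 ≤ N →
      ∃ σeq : ProbabilityMeasure ℝ,
        (∀ σ : ProbabilityMeasure ℝ,
          SinhGordon.energyPlus b kappa N σeq ≤ SinhGordon.energyPlus b kappa N σ) ∧
        (∀ σ' : ProbabilityMeasure ℝ,
          (∀ σ : ProbabilityMeasure ℝ,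
            SinhGordon.energyPlus b kappa N σ' ≤ SinhGordon.energyPlus b kappa N σ) →
          σ' = σeq) ∧
        SinhGordon.energyPlus b kappa N σeq ≠ ⊤ ∧
        SinhGordon.energyPlus b kappa N σeq ≠ ⊥ ∧
        ∀ p : ℕ, p ≤ N →
          SinhGordon.partitionFunction b kappa N p ≤
            ENNReal.ofReal (Real.exp
              (-(N : ℝ) ^ 2 * (SinhGordon.energyPlus b kappa N σeq).toReal
                + C * (N * Real.log N ^ 2))) := by
  obtain ⟨C₁, hC₁, hint⟩ := SinhGordon.exists_partitionIntegrand_le hb hb' (kappa := kappa)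
  set G := ∫ x in Set.Ioi (0 : ℝ), |SinhGordon.profileRem (1 / 2) (SinhGordon.plusAmplitude b) x|
  have hG : 0 ≤ G := integral_nonneg fun _ => abs_nonneg _
  set D := |Real.log (2 * π / kappa)|
  have hD : 0 ≤ D := abs_nonneg _
  have he3 := Real.exp_pos 3
  -- The error per particle is at most `A + B log N`, with `A` and `B` the two parentheses. As `log
  -- N ≥ 1/2`, one has `1 ≤ 4 (log N)²` and `log N ≤ 2 (log N)²`, whence `4 A + 2 B`.
  refine ⟨4 * (4 * Real.exp 3 * (kappa + G) + C₁ + 1 + D / 2) + 2 * (4 * Real.exp 3 + 3),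
    by positivity, fun N hN => ?_⟩
  have hN2 : (2 : ℝ) ≤ N := by exact_mod_cast hN
  have hN0 : (0 : ℝ) < N := by linarith
  have hL : 1 / 2 ≤ Real.log N := by
    have := Real.log_le_log two_pos hN2
    linarith [Real.log_two_gt_d9]
  have hcard : Fintype.card (Fin N) = N := Fintype.card_fin N
  let σ₁ : ProbabilityMeasure ℝ := ⟨SinhGordon.smearedMeasure N (fun _ : Fin N => (0 : ℝ)),
    SinhGordon.isProbabilityMeasure_smearedMeasure N _ (by omega)⟩
  have hσ₁ : SinhGordon.energyNN b kappa N σ₁ ≠ ⊤ := ne_top_of_le_ne_top ENNReal.ofReal_ne_top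
    (SinhGordon.energyNN_smearedMeasure_le hb hb' hkappa hN hcard (fun _ => 0))
  obtain ⟨σ₀, hσ₀⟩ := SinhGordon.exists_energyNN_minimizer (b := b) hkappa hN hσ₁
  have hfin : SinhGordon.energyNN b kappa N σ₀ ≠ ⊤ := ne_top_of_le_ne_top hσ₁ (hσ₀ σ₁)
  have hE := SinhGordon.energyPlus_eq hb hb' hkappa N
  simp only [hE, EReal.coe_ennreal_le_coe_ennreal_iff]
  refine ⟨σ₀, hσ₀, fun σ' h' => SinhGordon.energyNN_minimizer_unique hb hb' hN hfin hσ₀ h',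
    by simpa using hfin, EReal.coe_ennreal_ne_bot _, fun p hp => ?_⟩
  rw [EReal.toReal_coe_ennreal]
  refine (SinhGordon.partitionFunction_le hb hb' hkappa hint hN hp hσ₀).trans
    (ENNReal.ofReal_le_ofReal ?_)
  have hm := SinhGordon.toReal_minimum_le hb hb' hkappa hN hσ₀
  set m := (SinhGordon.energyNN b kappa N σ₀).toReal
  have h1 := SinhGordon.inv_log_pow_mul_sqrt_pow_le hkappa hN
  rw [mul_left_comm]
  refine (mul_le_mul_of_nonneg_left h1 (Real.exp_pos _).le).trans ?_
  rw [← Real.exp_add, Real.exp_le_exp]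
  set L := Real.log N
  have hL1 : 1 ≤ 4 * L ^ 2 := by nlinarith
  have hL2 : L ≤ 2 * L ^ 2 := by nlinarith
  have h2 : 4 * m + (2 * L + C₁) + (1 + (D + L) / 2) ≤
      (4 * Real.exp 3 * (kappa + G) + C₁ + 1 + D / 2) * 1 + (4 * Real.exp 3 + 3) * L := by
    linarith
  have h3 : (4 * Real.exp 3 * (kappa + G) + C₁ + 1 + D / 2) * 1 + (4 * Real.exp 3 + 3) * L ≤
      (4 * Real.exp 3 * (kappa + G) + C₁ + 1 + D / 2) * (4 * L ^ 2) +
        (4 * Real.exp 3 + 3) * (2 * L ^ 2) := by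
    gcongr
  have h4 := mul_le_mul_of_nonneg_left (h2.trans h3) hN0.le
  linarith
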